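/- Setting. Let $\mathbf U(\theta)=U_M(\theta_M)\cdots U_1(\theta_1)$ be a parametrized circuit on $N$ qubits with gates $U_\nu(\theta_\nu)=e^{-i\theta_\nu\Omega_\nu}$, $\Omega_\nu$ Hermitian, and let the gates be grouped consecutively into blocks, $\mathbf U=B_{K}\cdots B_1$. The support $s(B_k)$ is the set of qubits on which the gates of $B_k$ act non-trivially. Let $H=\sum_j\lambda_jh_j$ be a Hamiltonian with real coefficients $\lambda_j\ne0$ and distinct Pauli strings $h_j$, such that every qubit in the support of some $h_j$ lies in some $s(B_k)$, and let $C(\theta)=\operatorname{tr}(\rho_0\mathbf U(\theta)^\dagger H\,\mathbf U(\theta))$ with $\rho_0=|0\cdots0\rangle\langle0\cdots0|$. Fix a gate $U_\mu$ (the differential gate) whose generator $\Omega_\mu$ is a Pauli string other than the identity, let $B_{k(\mu)}$ be the block containing it (the differential block), and write $B_{k(\mu)}=R\,U_\mu L$, where $L$ and $R$ are the products of the gates of that block before and after $U_\mu$. The parameters $\theta$ are random, with a law for which the random unitaries $B_k$ ($k\neq k(\mu)$), $L$, $U_\mu$, $R$ are mutually independent, each $B_k$ with $k\ne k(\mu)$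 is a unitary $2$-design on $s(B_k)$, and both $L$ and $R$ are unitary $2$-designs on $s(B_{k(\mu)})$. Let $r$ be the maximum of the support sizes of the $h_j$, $\beta=\max_k|s(B_k)|$ the maximum block size, and $\chi$ the maximum over the qubits $q$ of the local depth, i.e. of the number of blocks $B_k$ with $q\in s(B_k)$. Theorem. The variance of $\partial_\mu C=\partial C/\partial\theta_\mu$ over the random parameters satisfies $$\operatorname{Var}[\partial_\mu C]\;\ge\;4^{-r\chi\beta}\sum_j 2\lambda_j^2,$$ where $j$ runs over the indices for which $h_j$ acts non-trivially on $s(B_{k(\mu)})$. Consequently, circuits of finite local depth have no barren plateaus: consider a sequence of such settings whose numbers of qubits $N_n$ tend to infinity, whose maximum interaction ranges, maximum local depths and maximum block sizes are bounded by constants $r,\chi,\beta$, and for which the sum of $\lambda_j^2$ over the terms non-trivial on the support of the differential block is at least a constant $c>0$. Then $\operatorname{Var}[\partial_\mu C]\ge 2c\,4^{-r\chi\beta}$ for every member of the sequence; in particular the variance does not vanish exponentially, i.e. there is no $b>1$ with $\operatorname{Var}[\partial_\mu C]=O(b^{-N_n})$. -/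

import Mathlib

open MeasureTheory ProbabilityTheory

/-! ### Unitary designs -/

/-- The product (Borel) measurable structure on complex matrices. -/
noncomputable instance instMeasurableSpaceComplexMatrix (m n : Type*) : MeasurableSpace (Matrix m n ℂ) :=
  inferInstanceAs (MeasurableSpace (m → n → ℂ))

/-- The Borel measurable structure on the unitary group. -/
noncomputable instance instMeasurableSpaceUnitaryGroup (d : Type*) [Fintype d] [DecidableEq d] :
    MeasurableSpace (Matrix.unitaryGroup d ℂ) := borel _

instance instBorelSpaceUnitaryGroup (d : Type*) [Fintype d] [DecidableEq d] :
    BorelSpace (Matrix.unitaryGroup d ℂ) := ⟨rfl⟩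

/-- The unitary group is compact. -/
instance instCompactSpaceUnitaryGroup (d : Type*) [Fintype d] [DecidableEq d] :
    CompactSpace (Matrix.unitaryGroup d ℂ) := by
  apply isCompact_iff_compactSpace.mp
  have hc : IsCompact
      (Set.pi Set.univ fun _ : d => Set.pi Set.univ fun _ : d => Metric.closedBall (0 : ℂ) 1) :=
    isCompact_univ_pi fun _ => isCompact_univ_pi fun _ => isCompact_closedBall 0 1
  refine hc.of_isClosed_subset (?_ : IsClosed ((Matrix.unitaryGroup d ℂ : Set (Matrix d d ℂ)))) ?_
  · have : ((Matrix.unitaryGroup d ℂ : Submonoid (Matrix d d ℂ)) : Set (Matrix d d ℂ))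
        = {A | star A * A = 1} ∩ {A | A * star A = 1} := by
      ext A
      exact Unitary.mem_iff
    rw [this]
    exact (isClosed_eq (by fun_prop) continuous_const).inter
      (isClosed_eq (by fun_prop) continuous_const)
  · intro A hA i _ j _
    simpa using entry_norm_bound_of_unitary hA i j

/-- The normalized Haar measure on the unitary group. -/
noncomputable def haarUnitary (d : Type*) [Fintype d] [DecidableEq d] :
    Measure (Matrix.unitaryGroup d ℂ) :=
  Measure.haarMeasure (⊤ : TopologicalSpace.PositiveCompacts (Matrix.unitaryGroup d ℂ))

/-- The random unitary `V` is a unitary `t`-design: every monomial of degree `t` in the entries of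
`V` and degree `t` in the entries of `V†` has the same average as under the Haar measure. -/
def IsUnitaryDesign {Ω d : Type*} [MeasurableSpace Ω] [Fintype d] [DecidableEq d] (t : ℕ)
    (P : Measure Ω) (V : Ω → Matrix.unitaryGroup d ℂ) : Prop :=
  ∀ i j k l : Fin t → d,
    ∫ ω, ∏ a, ((V ω : Matrix d d ℂ) (i a) (j a) *
        (V ω : Matrix d d ℂ).conjTranspose (k a) (l a)) ∂P =
      ∫ W, ∏ a, ((W : Matrix d d ℂ) (i a) (j a) *
        (W : Matrix d d ℂ).conjTranspose (k a) (l a)) ∂(haarUnitary d)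

/-! ### Operators on `N` qubits -/

/-- Operators on `N` qubits, as matrices in the computational basis. -/
abbrev QOp (N : ℕ) := Matrix (Fin N → Fin 2) (Fin N → Fin 2) ℂ

/-- The operator `V ⊗ I`, with `V` acting on the qubits in `s` and `I` on the other ones. -/
def embedOp {N : ℕ} (s : Finset (Fin N)) (V : Matrix (s → Fin 2) (s → Fin 2) ℂ) : QOp N :=
  Matrix.of fun x y =>
    if ∀ i, i ∉ s → x i = y i then V (fun i => x i) (fun i => y i) else 0

open Classical in
/-- The support of an operator: the qubits on which it acts non-trivially, that is, the qubits `q`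
for which the operator is not of the form `V ⊗ I_q`. -/
noncomputable def opSupport {N : ℕ} (A : QOp N) : Finset (Fin N) :=
  Finset.univ.filter fun q => ¬ ∃ V, A = embedOp (Finset.univ.erase q) V

/-- The random `N`-qubit operator `B` is a local `t`-design on the qubits in `s`. -/
def IsLocalDesign {Ω : Type*} [MeasurableSpace Ω] {N : ℕ} (t : ℕ) (P : Measure Ω)
    (s : Finset (Fin N)) (B : Ω → QOp N) : Prop :=
  ∃ V : Ω → Matrix.unitaryGroup (s → Fin 2) ℂ,
    Measurable V ∧ (∀ ω, B ω = embedOp s (V ω)) ∧ IsUnitaryDesign t P V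

/-! ### Pauli strings -/

/-- The labels of the four Pauli matrices. -/
inductive Pauli
  | I | X | Y | Z
  deriving DecidableEq

instance : Fintype Pauli := ⟨{.I, .X, .Y, .Z}, by intro x; cases x <;> decide⟩

/-- The Pauli matrices. -/
def Pauli.toMatrix : Pauli → Matrix (Fin 2) (Fin 2) ℂ
  | .I => 1
  | .X => !![0, 1; 1, 0]
  | .Y => !![0, -Complex.I; Complex.I, 0]
  | .Z => !![1, 0; 0, -1]

/-- Pauli strings on `N` qubits. -/
abbrev PauliString (N : ℕ) := Fin N → Pauli

namespace PauliString

/-- The tensor product of the Pauli matrices in the string. -/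
noncomputable def toOp {N : ℕ} (h : PauliString N) : QOp N :=
  Matrix.of fun x y => ∏ i, (h i).toMatrix (x i) (y i)

/-- The qubits on which the string is not the identity. -/
def support {N : ℕ} (h : PauliString N) : Finset (Fin N) :=
  Finset.univ.filter fun i => h i ≠ Pauli.I

end PauliString

/-! ### Variational quantum eigensolvers with randomly initialized blocks -/

/-- The data of a variational quantum eigensolver. The circuit is `U_M(θ_M) ⋯ U_1(θ_1)` with
`U_ν(θ_ν) = exp(-i θ_ν Ω_ν)`, and its gates are grouped into consecutive blocks. -/
structure VQE where
  /-- the number of qubits -/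
  numQubits : ℕ
  /-- the number of gates, which is the number of parameters -/
  numGates : ℕ
  /-- the number of blocks -/
  numBlocks : ℕ
  /-- the generators `Ω_ν` of the gates -/
  gen : Fin numGates → QOp numQubits
  gen_isHermitian : ∀ ν, (gen ν).IsHermitian
  /-- the index of the block to which a gate belongs -/
  block : Fin numGates → Fin numBlocks
  block_mono : Monotone block
  /-- the joint law of the randomly initialized parameters -/
  law : Measure (Fin numGates → ℝ)
  law_isProbability : IsProbabilityMeasure law
  /-- the index `μ` of the differential gate -/
  diffGate : Fin numGates
  /-- the coefficients `λ_h` in the Pauli decomposition `H = ∑ λ_h h` of the Hamiltonian -/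
  coeff : PauliString numQubits → ℝ

namespace VQE

variable (V : VQE)

/-- The gate `U_ν(t) = exp(-i t Ω_ν)`. -/
noncomputable def gate (ν : Fin V.numGates) (t : ℝ) : QOp V.numQubits :=
  NormedSpace.exp ((-(Complex.I * (t : ℂ))) • V.gen ν)

/-- The ordered product of the gates whose index is in `S`; later gates stand on the left. -/
noncomputable def gateProd (S : Finset (Fin V.numGates)) (θ : Fin V.numGates → ℝ) :
    QOp V.numQubits :=
  (((List.finRange V.numGates).reverse.filter (· ∈ S)).map fun ν => V.gate ν (θ ν)).prod

/-- The whole circuit. -/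
noncomputable def circuit (θ : Fin V.numGates → ℝ) : QOp V.numQubits :=
  V.gateProd Finset.univ θ

/-- The initial state `|0⋯0⟩⟨0⋯0|`. -/
def initialState : QOp V.numQubits := Matrix.single 0 0 1

/-- The Hamiltonian. -/
noncomputable def hamiltonian : QOp V.numQubits := ∑ h, (V.coeff h : ℂ) • h.toOp

/-- The cost function `C(θ) = tr(ρ₀ U† H U)`. -/
noncomputable def cost (θ : Fin V.numGates → ℝ) : ℝ :=
  (Matrix.trace (V.initialState * (V.circuit θ).conjTranspose * V.hamiltonian * V.circuit θ)).re

/-- The partial derivative of the cost function in the differential parameter. -/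
noncomputable def costDeriv (θ : Fin V.numGates → ℝ) : ℝ :=
  deriv (fun t => V.cost (Function.update θ V.diffGate t)) (θ V.diffGate)

/-- The variance of the cost derivative over the circuit ensemble. -/
noncomputable def gradVariance : ℝ := variance V.costDeriv V.law

/-- The Pauli terms of the Hamiltonian. -/
noncomputable def terms : Finset (PauliString V.numQubits) :=
  Finset.univ.filter fun h => V.coeff h ≠ 0

/-- The maximum interaction range of the Hamiltonian. -/
noncomputable def interactionRange : ℕ := V.terms.sup fun h => h.support.card

/-- The support of a block: the qubits on which the gates in the block act. -/
noncomputable def blockSupport (k : Fin V.numBlocks) : Finset (Fin V.numQubits) :=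
  (Finset.univ.filter fun ν => V.block ν = k).biUnion fun ν => opSupport (V.gen ν)

/-- The differential block. -/
def diffBlock : Fin V.numBlocks := V.block V.diffGate

/-- The maximum block size. -/
noncomputable def maxBlockSize : ℕ := Finset.univ.sup fun k => (V.blockSupport k).card

/-- The local depth at a qubit: the number of blocks acting on it. -/
noncomputable def localDepth (q : Fin V.numQubits) : ℕ :=
  (Finset.univ.filter fun k => q ∈ V.blockSupport k).card

/-- The maximum local depth. -/
noncomputable def maxLocalDepth : ℕ := Finset.univ.sup V.localDepth

/-- The Pauli terms of the Hamiltonian that are non-trivial on the support of the differential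
block. -/
noncomputable def relevantTerms : Finset (PauliString V.numQubits) :=
  V.terms.filter fun h => (h.support ∩ V.blockSupport V.diffBlock).Nonempty

/-- The segments of the circuit: the blocks other than the differential one, and the three parts of
the differential block `R U_μ L`. -/
inductive Segment (K : ℕ) (k₀ : Fin K)
  | block (k : Fin K) (hk : k ≠ k₀)
  | left
  | diff
  | right

/-- The gates in a segment. The sub-block `L` consists of the gates of the differential block before
the differential gate, `R` of those after it. -/
def segmentGates : Segment V.numBlocks V.diffBlock → Finset (Fin V.numGates)
  | .block k _ => Finset.univ.filter fun ν => V.block ν = k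
  | .left => Finset.univ.filter fun ν => V.block ν = V.diffBlock ∧ ν < V.diffGate
  | .diff => {V.diffGate}
  | .right => Finset.univ.filter fun ν => V.block ν = V.diffBlock ∧ V.diffGate < ν

/-- The random unitary of a segment. -/
noncomputable def segmentUnitary (σ : Segment V.numBlocks V.diffBlock)
    (θ : Fin V.numGates → ℝ) : QOp V.numQubits :=
  V.gateProd (V.segmentGates σ) θ

/-- The standing assumptions: the blocks are independent local `2`-designs, the differential gate is
generated by a (non-identity) Pauli string and is sandwiched, inside its block, by two independent
local `2`-designs on the support of the block, and the circuit covers the Hamiltonian. -/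
structure Assumptions : Prop where
  block_design : ∀ k (hk : k ≠ V.diffBlock),
    IsLocalDesign 2 V.law (V.blockSupport k) (V.segmentUnitary (.block k hk))
  left_design : IsLocalDesign 2 V.law (V.blockSupport V.diffBlock) (V.segmentUnitary .left)
  right_design : IsLocalDesign 2 V.law (V.blockSupport V.diffBlock) (V.segmentUnitary .right)
  indep : iIndepFun V.segmentUnitary V.law
  gen_pauli : ∃ g : PauliString V.numQubits, g.support.Nonempty ∧ V.gen V.diffGate = g.toOp
  covers : ∀ h ∈ V.terms, ∀ q ∈ h.support, ∃ k, q ∈ V.blockSupport k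

end VQE

/-- A sequence of variational quantum eigensolvers has a barren plateau (for the chosen parameters)
if the variance of the cost derivative vanishes exponentially in the number of qubits. -/
def HasBarrenPlateau (V : ℕ → VQE) : Prop :=
  ∃ b : ℝ, 1 < b ∧
    (fun n => (V n).gradVariance) =O[Filter.atTop] fun n => (b ^ (V n).numQubits)⁻¹

/-! In the Heisenberg picture, expand the evolved observable in Pauli strings and follow the matrix
of second moments of its coefficients. An independent 2-design on `s` acts linearly on this matrix
through the Haar moments `twirl`. Invariance under local unitaries yields what is needed about them.
Letters outside `s` are untouched. Cross moments vanish unless the two output strings coincide on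
`s`. The diagonal is a transition probability, uniform over the reachable outputs that are
non-trivial on `s` when the input is non-trivial there. Since only `4 ^ |s|` strings are reachable,
each such transition has weight at least `4 ^ (-|s|)` (`inv_le_twirl`).

The lower bound keeps one path for each relevant Hamiltonian term: every block that meets the string
turns its non-trivial letters on that block into `Z`, and every other block leaves it alone at no
cost. The support of the string never changes, so only the blocks meeting the support of the term
cost a factor, and there are at most `r * χ` of them. The final string consists of `I` and `Z`, so
its expectation in the initial state is 1.

Differentiating inserts a commutator `i[g, ·]` into the differential block. It multiplies squared
coefficients by 4 on strings anticommuting with `g` and kills the others. Half of the `4 ^ |s|`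
strings on the block anticommute with `g`. The design `R` reaches each of them and `L` leads back to
the chosen path, which gives `(4 ^ |s| / 2) * 4 ^ (-|s|) * 4 * 4 ^ (-|s|) = 2 * 4 ^ (-|s|)`
(`MomentBound.commutator_step`). The differential gate itself is a local unitary absorbed by the
invariance of `L`.

The derivative has mean zero: `R` kills the mean of every coefficient non-trivial on the block, the
commutator sees no others, and the remaining evolution is linear in the means. Hence the variance is
a second moment. Qubits outside all blocks carry only identities, so once all blocks have acted no
cross moments survive, and discarding the remaining diagonal terms is harmless. -/

/-! ### Multiplication of Pauli strings -/

namespace Pauli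

/-- The product of two Pauli matrices up to a phase. -/
def mul : Pauli → Pauli → Pauli
  | .I, q => q
  | p, .I => p
  | .X, .X => .I
  | .X, .Y => .Z
  | .X, .Z => .Y
  | .Y, .X => .Z
  | .Y, .Y => .I
  | .Y, .Z => .X
  | .Z, .X => .Y
  | .Z, .Y => .X
  | .Z, .Z => .I

/-- The phase in the product of two Pauli matrices. -/
def phase : Pauli → Pauli → ℂ
  | .X, .Y => Complex.I
  | .Y, .X => -Complex.I
  | .Y, .Z => Complex.I
  | .Z, .Y => -Complex.I
  | .Z, .X => Complex.I
  | .X, .Z => -Complex.I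
  | _, _ => 1

/-- The sign `p q = sign p q • q p`. -/
def sign : Pauli → Pauli → ℤ
  | .X, .Y => -1
  | .Y, .X => -1
  | .Y, .Z => -1
  | .Z, .Y => -1
  | .Z, .X => -1
  | .X, .Z => -1
  | _, _ => 1

theorem mul_mul_cancel_right (p q : Pauli) : mul (mul p q) q = p := by
  cases p <;> cases q <;> rfl

theorem mul_comm (p q : Pauli) : mul p q = mul q p := by
  cases p <;> cases q <;> rfl

theorem mul_I (p : Pauli) : mul p .I = p := by cases p <;> rfl

theorem sign_I (p : Pauli) : sign p .I = 1 := by cases p <;> rfl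

theorem sign_comm (p q : Pauli) : sign p q = sign q p := by
  cases p <;> cases q <;> rfl

theorem sign_mul_left (p q r : Pauli) : sign (mul p q) r = sign p r * sign q r := by
  cases p <;> cases q <;> cases r <;> rfl

theorem sign_self (p : Pauli) : sign p p = 1 := by cases p <;> rfl

theorem phase_sq (p q : Pauli) : phase p q ^ 2 = sign p q := by
  cases p <;> cases q <;> simp [phase, sign]

theorem sign_eq_or (p q : Pauli) : sign p q = 1 ∨ sign p q = -1 := by
  cases p <;> cases q <;> simp [sign]

theorem toMatrix_mul (p q : Pauli) :
    p.toMatrix * q.toMatrix = phase p q • (mul p q).toMatrix := by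
  cases p <;> cases q <;> ext i j <;> fin_cases i <;> fin_cases j <;>
    simp [toMatrix, phase, mul]

theorem phase_comm (p q : Pauli) : phase p q = sign p q * phase q p := by
  cases p <;> cases q <;> simp [phase, sign]

theorem toMatrix_isHermitian (p : Pauli) (a b : Fin 2) :
    star (p.toMatrix a b) = p.toMatrix b a := by
  cases p <;> fin_cases a <;> fin_cases b <;> simp [toMatrix]

theorem trace_toMatrix (p : Pauli) : ∑ a, p.toMatrix a a = if p = .I then 2 else 0 := by
  cases p <;> simp [toMatrix]

theorem sum_univ {M : Type*} [AddCommMonoid M] (f : Pauli → M) :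
    ∑ p, f p = f .I + (f .X + (f .Y + f .Z)) := by
  change Finset.sum ⟨_, _⟩ _ = _
  simp [Finset.sum]

/-- Completeness of the Pauli basis: the sum of `p ⊗ p` is twice the swap operator. -/
theorem sum_toMatrix_mul_toMatrix (a b c d : Fin 2) :
    ∑ p : Pauli, p.toMatrix a b * p.toMatrix c d = if a = d ∧ b = c then 2 else 0 := by
  rw [sum_univ]
  fin_cases a <;> fin_cases b <;> fin_cases c <;> fin_cases d <;>
    simp [toMatrix, one_add_one_eq_two]

theorem exists_sign_ne {p q : Pauli} (h : p ≠ q) : ∃ t, sign p t ≠ sign q t := by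
  revert p q; decide

theorem exists_sign_neg {p : Pauli} (h : p ≠ .I) : ∃ t, sign p t = -1 := by
  revert p; decide

/-- If the two letters differ, the third non-trivial letter works; if they agree, either of the
other two does. -/
theorem exists_sign_neg_both {p q : Pauli} (hp : p ≠ .I) (hq : q ≠ .I) :
    ∃ t, sign p t = -1 ∧ sign q t = -1 := by
  revert p q; decide

theorem toMatrix_zero_zero (p : Pauli) :
    p.toMatrix 0 0 = if p = .I ∨ p = .Z then 1 else 0 := by
  cases p <;> simp [toMatrix]

end Pauli

namespace PauliString

variable {N : ℕ}

theorem two_pow_ne : (2 ^ N : ℂ) ≠ 0 := pow_ne_zero _ two_ne_zero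

/-- The product of two Pauli strings up to a phase. -/
def mul (P Q : PauliString N) : PauliString N := fun i => (P i).mul (Q i)

/-- The phase in the product of two Pauli strings. -/
noncomputable def phase (P Q : PauliString N) : ℂ := ∏ i, (P i).phase (Q i)

/-- The sign in `P Q = sign P Q • Q P`. -/
def sign (P Q : PauliString N) : ℤ := ∏ i, (P i).sign (Q i)

/-- The string that is `t` on the qubit `q` and trivial elsewhere. -/
def single (q : Fin N) (t : Pauli) : PauliString N := Function.update (fun _ => .I) q t

theorem mul_mul_cancel_right (P Q : PauliString N) : mul (mul P Q) Q = P :=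
  funext fun _ => Pauli.mul_mul_cancel_right _ _

theorem toOp_apply (P : PauliString N) (x y) :
    P.toOp x y = ∏ i, (P i).toMatrix (x i) (y i) := rfl

theorem toOp_mul (P Q : PauliString N) : P.toOp * Q.toOp = phase P Q • (mul P Q).toOp := by
  ext x z
  simp only [Matrix.mul_apply, toOp_apply, Matrix.smul_apply, ← Finset.prod_mul_distrib, phase,
    smul_eq_mul, mul]
  refine (Fintype.prod_sum fun i b => (P i).toMatrix (x i) b * (Q i).toMatrix b (z i)).symm.trans
    (Finset.prod_congr rfl fun i _ => ?_)
  have := congrFun (congrFun (Pauli.toMatrix_mul (P i) (Q i)) (x i)) (z i)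
  simpa [Matrix.mul_apply] using this

theorem toOp_one : toOp (N := N) (fun _ => .I) = 1 := by
  ext x y
  simp only [toOp_apply, Pauli.toMatrix, Matrix.one_apply]
  rw [Finset.prod_ite_zero]
  simp [funext_iff]

theorem sign_comm (P Q : PauliString N) : sign P Q = sign Q P :=
  Finset.prod_congr rfl fun _ _ => Pauli.sign_comm _ _

theorem sign_self (P : PauliString N) : sign P P = 1 :=
  Finset.prod_eq_one fun _ _ => Pauli.sign_self _

theorem sign_mul_left (P Q R : PauliString N) : sign (mul P Q) R = sign P R * sign Q R := by
  simp only [sign, mul, Pauli.sign_mul_left, Finset.prod_mul_distrib]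

theorem sign_eq_or (P Q : PauliString N) : sign P Q = 1 ∨ sign P Q = -1 := by
  unfold sign
  induction (Finset.univ : Finset (Fin N)) using Finset.induction_on with
  | empty => simp
  | insert a s ha ih =>
    rw [Finset.prod_insert ha]
    rcases Pauli.sign_eq_or (P a) (Q a) with h | h <;> rcases ih with h' | h' <;> simp [h, h']

theorem phase_sq (P Q : PauliString N) : phase P Q ^ 2 = sign P Q := by
  simp [phase, sign, ← Finset.prod_pow, Pauli.phase_sq]

theorem toOp_mul_comm (P Q : PauliString N) :
    P.toOp * Q.toOp = (sign P Q : ℂ) • (Q.toOp * P.toOp) := by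
  have h1 : mul P Q = mul Q P := funext fun _ => Pauli.mul_comm _ _
  have h2 : phase P Q = sign P Q * phase Q P := by
    simp only [phase, sign, Int.cast_prod, ← Finset.prod_mul_distrib]
    exact Finset.prod_congr rfl fun _ _ => Pauli.phase_comm _ _
  rw [toOp_mul, toOp_mul, h1, h2, smul_smul]

theorem toOp_mul_self (P : PauliString N) : P.toOp * P.toOp = 1 := by
  have h1 : mul P P = fun _ => .I := funext fun i => by
    simp only [mul]; cases P i <;> rfl
  have h2 : phase P P = 1 := Finset.prod_eq_one fun i _ => by cases P i <;> rfl
  rw [toOp_mul, h1, h2, one_smul, toOp_one]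

theorem toOp_isHermitian (P : PauliString N) : P.toOp.IsHermitian := by
  ext x y
  simp only [Matrix.conjTranspose_apply, toOp_apply, star_prod, Pauli.toMatrix_isHermitian]

theorem trace_toOp (P : PauliString N) :
    P.toOp.trace = if P = fun _ => .I then 2 ^ N else 0 := by
  simp only [Matrix.trace, Matrix.diag, toOp_apply]
  refine (Fintype.prod_sum fun i b => (P i).toMatrix b b).symm.trans ?_
  simp only [Pauli.trace_toMatrix]
  rw [Finset.prod_ite_zero]
  simp [funext_iff]

theorem mul_eq_one_iff (P Q : PauliString N) : (mul P Q = fun _ => .I) ↔ P = Q := by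
  simp only [funext_iff, mul]
  refine forall_congr' fun i => ?_
  cases P i <;> cases Q i <;> simp [Pauli.mul]

theorem trace_toOp_mul_toOp (P Q : PauliString N) :
    (P.toOp * Q.toOp).trace = if P = Q then 2 ^ N else 0 := by
  split_ifs with h
  · subst h; rw [toOp_mul_self]; simp
  · rw [toOp_mul, Matrix.trace_smul, trace_toOp, if_neg (by rwa [mul_eq_one_iff]), smul_zero]

theorem sum_toOp_mul_toOp (x y z w : Fin N → Fin 2) :
    ∑ P : PauliString N, P.toOp x y * P.toOp z w = if x = w ∧ y = z then 2 ^ N else 0 := by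
  simp only [toOp_apply, ← Finset.prod_mul_distrib]
  refine (Fintype.prod_sum fun i (p : Pauli) =>
    p.toMatrix (x i) (y i) * p.toMatrix (z i) (w i)).symm.trans ?_
  simp only [Pauli.sum_toMatrix_mul_toMatrix]
  rw [Finset.prod_ite_zero]
  simp [funext_iff, forall_and]

theorem sign_single (P : PauliString N) (q : Fin N) (t : Pauli) :
    sign P (single q t) = (P q).sign t := by
  unfold sign
  rw [Finset.prod_eq_single q]
  · simp [single]
  · intro b _ hb; simp [single, hb, Pauli.sign_I]
  · simp

theorem toOp_zero_zero (P : PauliString N) :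
    P.toOp 0 0 = if ∀ i, P i = .I ∨ P i = .Z then 1 else 0 := by
  simp only [toOp_apply, Pi.zero_apply, Pauli.toMatrix_zero_zero]
  rw [Finset.prod_ite_zero]
  simp

/-! ### Pauli coefficients -/

/-- The real coefficient of a Pauli string in an operator. -/
noncomputable def coeff (Q : PauliString N) (A : QOp N) : ℝ := ((2 ^ N : ℝ))⁻¹ * (Q.toOp * A).trace.re

theorem trace_mul_re_of_isHermitian {n : Type*} [Fintype n] {A B : Matrix n n ℂ}
    (hA : A.IsHermitian) (hB : B.IsHermitian) : (((A * B).trace.re : ℝ) : ℂ) = (A * B).trace := by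
  rw [← Complex.conj_eq_iff_re, ← Complex.star_def, ← Matrix.trace_conjTranspose,
    Matrix.conjTranspose_mul, hA.eq, hB.eq, Matrix.trace_mul_comm]

theorem ofReal_coeff (Q : PauliString N) {A : QOp N} (hA : A.IsHermitian) :
    (coeff Q A : ℂ) = (2 ^ N : ℂ)⁻¹ * (Q.toOp * A).trace := by
  rw [coeff, Complex.ofReal_mul, trace_mul_re_of_isHermitian Q.toOp_isHermitian hA]
  simp

theorem coeff_real_smul (Q : PauliString N) (c : ℝ) (A : QOp N) :
    coeff Q ((c : ℂ) • A) = c * coeff Q A := by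
  simp [coeff]; ring

theorem coeff_sum (Q : PauliString N) {ι : Type*} (s : Finset ι) (A : ι → QOp N) :
    coeff Q (∑ i ∈ s, A i) = ∑ i ∈ s, coeff Q (A i) := by
  simp [coeff, Finset.mul_sum, Matrix.trace_sum]

theorem coeff_toOp (P Q : PauliString N) : coeff Q P.toOp = if Q = P then 1 else 0 := by
  rw [coeff, trace_toOp_mul_toOp]
  split_ifs
  · have : ((2 : ℂ) ^ N).re = 2 ^ N := by exact_mod_cast Complex.ofReal_re ((2 : ℝ) ^ N)
    rw [this]; exact inv_mul_cancel₀ (by positivity)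
  · simp

theorem sum_trace_smul_toOp (A : QOp N) :
    ∑ Q : PauliString N, ((2 ^ N : ℂ)⁻¹ * (Q.toOp * A).trace) • Q.toOp = A := by
  ext x y
  rw [Matrix.sum_apply]
  simp only [Matrix.smul_apply, smul_eq_mul, Matrix.trace, Matrix.diag, Matrix.mul_apply,
    mul_assoc, ← Finset.mul_sum]
  rw [inv_mul_eq_iff_eq_mul₀ two_pow_ne]
  calc _ = ∑ z, ∑ w, A w z * ∑ Q : PauliString N, Q.toOp z w * Q.toOp x y := by
        simp only [Finset.sum_mul, Finset.mul_sum]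
        rw [Finset.sum_comm]
        refine Finset.sum_congr rfl fun z _ => ?_
        rw [Finset.sum_comm]
        refine Finset.sum_congr rfl fun w _ => Finset.sum_congr rfl fun Q _ => by ring
    _ = _ := by
        simp only [sum_toOp_mul_toOp, mul_ite, mul_zero]
        rw [Finset.sum_eq_single y, Finset.sum_eq_single x] <;> simp +contextual [mul_comm, eq_comm]

theorem sum_coeff_smul_toOp {A : QOp N} (hA : A.IsHermitian) :
    ∑ Q : PauliString N, (coeff Q A : ℂ) • Q.toOp = A := by
  simp only [ofReal_coeff _ hA, sum_trace_smul_toOp]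

/-- Parseval for the normalized trace. It makes the squared coefficients of an evolved string a
probability distribution, the source of both the bound 1 and the bound `4 ^ (-|s|)`. -/
theorem sum_coeff_sq {A : QOp N} (hA : A.IsHermitian) (hAA : A * A = 1) :
    ∑ Q : PauliString N, coeff Q A ^ 2 = 1 := by
  have h : (A * A).trace = (2 ^ N : ℂ) := by simp [hAA]
  nth_rewrite 1 [← sum_coeff_smul_toOp hA] at h
  rw [Finset.sum_mul, Matrix.trace_sum] at h
  have h2 : ∀ Q : PauliString N, (((coeff Q A : ℂ) • Q.toOp) * A).trace
      = 2 ^ N * ((coeff Q A ^ 2 : ℝ) : ℂ) := fun Q => by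
    rw [Matrix.smul_mul, Matrix.trace_smul, smul_eq_mul]
    have := ofReal_coeff Q hA
    rw [eq_inv_mul_iff_mul_eq₀ two_pow_ne] at this
    rw [← this]; push_cast; ring
  simp only [h2, ← Finset.mul_sum] at h
  have h3 := mul_left_cancel₀ two_pow_ne (h.trans (mul_one _).symm)
  exact_mod_cast h3

/-- The coefficients of the commutator `i[P, A]`. -/
theorem coeff_commutator (P Q : PauliString N) : ∃ η : ℝ,
    η ^ 2 = (if sign Q P = -1 then 4 else 0) ∧ ∀ A : QOp N, A.IsHermitian →
      coeff Q (Complex.I • (P.toOp * A - A * P.toOp)) = η * coeff (mul Q P) A := by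
  -- Cyclicity of the trace moves `P` from the commutator next to `Q`; the two orders differ by
  -- `sign Q P`.
  have key : ∀ A : QOp N, (Q.toOp * (Complex.I • (P.toOp * A - A * P.toOp))).trace
      = (Complex.I * (1 - sign Q P) * phase Q P) * ((mul Q P).toOp * A).trace := fun A => by
    have h1 : (Q.toOp * (A * P.toOp)).trace = sign Q P * (Q.toOp * P.toOp * A).trace := by
      rw [← mul_assoc, Matrix.trace_mul_comm, ← mul_assoc, toOp_mul_comm P Q, Matrix.smul_mul,
        Matrix.trace_smul, smul_eq_mul, sign_comm]
    rw [Matrix.mul_smul, Matrix.trace_smul, mul_sub, Matrix.trace_sub, h1, ← mul_assoc, toOp_mul,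
      Matrix.smul_mul, Matrix.trace_smul, smul_eq_mul, smul_eq_mul]
    ring
  rcases sign_eq_or Q P with h | h
  · refine ⟨0, by simp [h], fun A hA => ?_⟩
    rw [coeff, key, h]; simp
  · have h2 : (Complex.I * phase Q P) ^ 2 = 1 := by rw [mul_pow, phase_sq, h]; simp
    -- In the anticommuting case the phase is `±i`, so `i` times it is a real sign and `η = ±2`.
    obtain ⟨ε, hε, hε2⟩ : ∃ ε : ℝ, ε ^ 2 = 1 ∧ (ε : ℂ) = Complex.I * phase Q P := by
      rcases sq_eq_one_iff.mp h2 with h3 | h3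
      · exact ⟨1, by simp, by simp [h3]⟩
      · exact ⟨-1, by simp, by simp [h3]⟩
    refine ⟨2 * ε, by rw [if_pos h, mul_pow, hε]; norm_num, fun A hA => ?_⟩
    have h4 : Complex.I * (1 - ((sign Q P : ℤ) : ℂ)) * phase Q P = ((2 * ε : ℝ) : ℂ) := by
      rw [h]; push_cast; rw [hε2]; ring
    rw [coeff, key, h4, Complex.re_ofReal_mul, coeff]; ring

end PauliString

/-! ### Local operators -/

section Embed

variable {N : ℕ} (s : Finset (Fin N))

open scoped Kronecker in
theorem embedOp_eq_submatrix (V : Matrix (s → Fin 2) (s → Fin 2) ℂ) :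
    embedOp s V = (V ⊗ₖ (1 : Matrix ({i // i ∉ s} → Fin 2) ({i // i ∉ s} → Fin 2) ℂ)).submatrix
      (Equiv.piEquivPiSubtypeProd (· ∈ s) fun _ => Fin 2)
      (Equiv.piEquivPiSubtypeProd (· ∈ s) fun _ => Fin 2) := by
  ext x y
  simp [embedOp, Matrix.one_apply, funext_iff, Equiv.piEquivPiSubtypeProd]

theorem embedOp_mul (V W : Matrix (s → Fin 2) (s → Fin 2) ℂ) :
    embedOp s (V * W) = embedOp s V * embedOp s W := by
  rw [embedOp_eq_submatrix, embedOp_eq_submatrix, embedOp_eq_submatrix, Matrix.submatrix_mul_equiv,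
    ← Matrix.mul_kronecker_mul, one_mul]

theorem embedOp_one : embedOp s 1 = 1 := by
  rw [embedOp_eq_submatrix, Matrix.one_kronecker_one, Matrix.submatrix_one_equiv]

theorem embedOp_conjTranspose (V : Matrix (s → Fin 2) (s → Fin 2) ℂ) :
    embedOp s V.conjTranspose = (embedOp s V).conjTranspose := by
  rw [embedOp_eq_submatrix, embedOp_eq_submatrix, Matrix.conjTranspose_submatrix,
    Matrix.conjTranspose_kronecker, Matrix.conjTranspose_one]

theorem embedOp_add (V W : Matrix (s → Fin 2) (s → Fin 2) ℂ) :
    embedOp s (V + W) = embedOp s V + embedOp s W := by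
  ext x y; simp only [embedOp, Matrix.of_apply, Matrix.add_apply]; split_ifs <;> simp

theorem embedOp_zero : embedOp s 0 = 0 := by
  ext x y; simp [embedOp]

theorem embedOp_smul (c : ℂ) (V : Matrix (s → Fin 2) (s → Fin 2) ℂ) :
    embedOp s (c • V) = c • embedOp s V := by
  ext x y; simp [embedOp]

theorem embedOp_injective : Function.Injective (embedOp s) := by
  intro V W h
  ext a b
  have := congrFun (congrFun h (fun i => if hi : i ∈ s then a ⟨i, hi⟩ else 0))
    (fun i => if hi : i ∈ s then b ⟨i, hi⟩ else 0)
  simpa +contextual [embedOp] using this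

theorem continuous_embedOp : Continuous (embedOp s) := by
  refine continuous_matrix fun x y => ?_
  simp only [embedOp, Matrix.of_apply]
  split_ifs <;> fun_prop

/-- The embedding of local operators as a ring homomorphism. -/
noncomputable def embedRingHom : Matrix (s → Fin 2) (s → Fin 2) ℂ →+* QOp N where
  toFun := embedOp s
  map_one' := embedOp_one s
  map_mul' := embedOp_mul s
  map_zero' := embedOp_zero s
  map_add' := embedOp_add s

theorem embedOp_eq_sum (V : Matrix (s → Fin 2) (s → Fin 2) ℂ) :
    embedOp s V = ∑ i, ∑ j, V i j • embedOp s (Matrix.single i j 1) := by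
  conv_lhs => rw [Matrix.matrix_eq_sum_single V]
  change embedRingHom s _ = _
  rw [map_sum]
  refine Finset.sum_congr rfl fun i _ => ?_
  rw [map_sum]
  refine Finset.sum_congr rfl fun j _ => ?_
  change embedOp s _ = _
  rw [← embedOp_smul, Matrix.smul_single, smul_eq_mul, mul_one]

theorem mem_unitaryGroup_of_embedOp {V : Matrix (s → Fin 2) (s → Fin 2) ℂ}
    (h : (embedOp s V).conjTranspose * embedOp s V = 1) :
    V ∈ Matrix.unitaryGroup (s → Fin 2) ℂ := by
  rw [Matrix.mem_unitaryGroup_iff', Matrix.star_eq_conjTranspose]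
  apply embedOp_injective s
  rw [embedOp_mul, embedOp_conjTranspose, h, embedOp_one]

theorem embedOp_unitary (V : Matrix.unitaryGroup (s → Fin 2) ℂ) :
    (embedOp s (V : Matrix (s → Fin 2) (s → Fin 2) ℂ)).conjTranspose * embedOp s V = 1 := by
  rw [← embedOp_conjTranspose, ← embedOp_mul]
  have := Matrix.mem_unitaryGroup_iff'.mp V.2
  rw [Matrix.star_eq_conjTranspose] at this
  rw [this, embedOp_one]

theorem embedOp_unitary' (V : Matrix.unitaryGroup (s → Fin 2) ℂ) :
    embedOp s V * (embedOp s (V : Matrix (s → Fin 2) (s → Fin 2) ℂ)).conjTranspose = 1 :=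
  mul_eq_one_comm.mp (embedOp_unitary s V)

/-- The part of a Pauli string on `s`. -/
noncomputable def PauliString.localOp (P : PauliString N) : Matrix (s → Fin 2) (s → Fin 2) ℂ :=
  Matrix.of fun x y => ∏ i : s, (P i).toMatrix (x i) (y i)

theorem PauliString.embedOp_localOp {P : PauliString N} (hP : ∀ q ∉ s, P q = .I) :
    embedOp s (P.localOp s) = P.toOp := by
  ext x y
  simp only [embedOp, localOp, Matrix.of_apply, toOp_apply]
  have h1 : ∏ i : s, (P i).toMatrix (x i) (y i) = ∏ i ∈ s, (P i).toMatrix (x i) (y i) :=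
    Finset.prod_coe_sort s fun i => (P i).toMatrix (x i) (y i)
  have h2 : ∏ i ∈ sᶜ, (P i).toMatrix (x i) (y i) = if ∀ i, i ∉ s → x i = y i then 1 else 0 := by
    rw [Finset.prod_congr rfl (g := fun i => if x i = y i then (1 : ℂ) else 0), Finset.prod_ite_zero]
    · simp
    · intro i hi
      rw [hP i (by simpa using hi)]; simp [Pauli.toMatrix, Matrix.one_apply]
  rw [h1, ← Finset.prod_mul_prod_compl s, h2]
  split_ifs <;> simp

theorem PauliString.toOp_commute_embedOp {P : PauliString N} (hP : ∀ q ∈ s, P q = .I)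
    (V : Matrix (s → Fin 2) (s → Fin 2) ℂ) : P.toOp * embedOp s V = embedOp s V * P.toOp := by
  have h1 : ∀ x y, P.toOp x y = (if ∀ i ∈ s, x i = y i then 1 else 0) *
      ∏ i ∈ sᶜ, (P i).toMatrix (x i) (y i) := fun x y => by
    rw [toOp_apply, ← Finset.prod_mul_prod_compl s]
    congr 1
    rw [Finset.prod_congr rfl (g := fun i => if x i = y i then (1 : ℂ) else 0), Finset.prod_ite_zero]
    · simp
    · intro i hi
      rw [hP i hi]; simp [Pauli.toMatrix, Matrix.one_apply]
  ext x z
  simp only [Matrix.mul_apply]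
  -- The string is diagonal on `s` and the local operator is diagonal off `s`, so in each order of
  -- the product a single intermediate basis state contributes.
  rw [Finset.sum_eq_single (fun i => if i ∈ s then x i else z i),
    Finset.sum_eq_single (fun i => if i ∈ s then z i else x i)]
  · rw [h1, h1]
    simp +contextual only [embedOp, Matrix.of_apply, if_true, if_false, implies_true]
    rw [Finset.prod_congr rfl (g := fun i => (P i).toMatrix (x i) (z i)), mul_comm]
    · congr 2
      · funext i; simp
      · funext i; simp
      · refine Finset.prod_congr rfl fun i hi => ?_
        rw [if_neg (by simpa using hi)]
    · intro i hi
      rw [if_neg (by simpa using hi)]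
  · intro y _ hy
    simp only [embedOp, Matrix.of_apply, h1]
    by_contra hne
    apply hy
    simp only [mul_eq_zero, not_or, ite_eq_right_iff, not_forall, one_ne_zero] at hne
    obtain ⟨⟨h2, -⟩, ⟨h3, -⟩, -⟩ := hne
    funext i
    split_ifs with hi
    · exact h3 i hi
    · exact (h2 i hi).symm
  · simp
  · intro y _ hy
    simp only [embedOp, Matrix.of_apply, h1]
    by_contra hne
    apply hy
    simp only [mul_eq_zero, not_or, ite_eq_right_iff, not_forall, one_ne_zero] at hne
    obtain ⟨⟨⟨h2, -⟩, -⟩, ⟨h3, -⟩⟩ := hne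
    funext i
    split_ifs with hi
    · exact (h2 i hi).symm
    · exact h3 i hi
  · simp

/-- An operator trivial at `q` commutes with all Paulis at `q`, while a string non-trivial there
anticommutes with one of them. Both together would make a product of two invertible strings vanish.
-/
theorem PauliString.eq_I_of_toOp_eq_embedOp {P : PauliString N} {q : Fin N} {V}
    (h : P.toOp = embedOp (Finset.univ.erase q) V) : P q = .I := by
  by_contra hP
  obtain ⟨t, ht⟩ := Pauli.exists_sign_neg hP
  have hc := toOp_commute_embedOp (P := single q t) (Finset.univ.erase q)
    (fun i hi => by simp [single, Finset.ne_of_mem_erase hi]) V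
  rw [← h, toOp_mul_comm P, sign_single, ht] at hc
  have h0 : (single q t).toOp * P.toOp = 0 := by
    ext x y
    have := congrFun (congrFun hc x) y
    simp only [Matrix.smul_apply, smul_eq_mul, Int.cast_neg, Int.cast_one] at this
    rw [Matrix.zero_apply]; linear_combination this / 2
  have h1 : (1 : QOp N) = 0 := by
    calc (1 : QOp N) = ((single q t).toOp * P.toOp) * (P.toOp * (single q t).toOp) := by
          rw [mul_assoc, ← mul_assoc P.toOp, toOp_mul_self, one_mul, toOp_mul_self]
      _ = 0 := by rw [h0, zero_mul]
  exact one_ne_zero h1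

theorem PauliString.support_subset_opSupport (P : PauliString N) :
    P.support ⊆ opSupport P.toOp := by
  intro q hq
  simp only [opSupport, Finset.mem_filter, Finset.mem_univ, true_and]
  rintro ⟨V, hV⟩
  simp only [support, Finset.mem_filter] at hq
  exact hq.2 (eq_I_of_toOp_eq_embedOp hV)

end Embed

/-! ### Second moments of the Haar measure in the Pauli basis -/

section HaarInvariance

variable (d : Type*) [Fintype d] [DecidableEq d]

instance instIsProbabilityMeasureHaarUnitary : IsProbabilityMeasure (haarUnitary d) :=
  ⟨Measure.haarMeasure_self (K₀ := ⊤)⟩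

instance instIsHaarMeasureHaarUnitary : (haarUnitary d).IsHaarMeasure :=
  inferInstanceAs (Measure.IsHaarMeasure (Measure.haarMeasure _))

/-- A right translate of the Haar measure is again a left Haar probability measure, hence equal to
it by uniqueness. -/
instance instIsMulRightInvariantHaarUnitary : (haarUnitary d).IsMulRightInvariant where
  map_mul_right_eq_self g := by
    have h1 : IsProbabilityMeasure ((haarUnitary d).map (· * g)) :=
      Measure.isProbabilityMeasure_map (by fun_prop)
    exact Measure.isHaarMeasure_eq_of_isProbabilityMeasure _ _

theorem integrable_haarUnitary {f : Matrix.unitaryGroup d ℂ → ℝ} (hf : Continuous f) :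
    Integrable f (haarUnitary d) :=
  hf.integrable_of_hasCompactSupport (HasCompactSupport.of_compactSpace f)

end HaarInvariance

/-! ### Heisenberg evolution of Pauli strings and the Haar twirl -/

section Heisenberg

variable {N : ℕ}

/-- Heisenberg evolution of the operator `A` under `B`. -/
def heis (B A : QOp N) : QOp N := B.conjTranspose * A * B

theorem heis_mul (B C A : QOp N) : heis (B * C) A = heis C (heis B A) := by
  simp only [heis, Matrix.conjTranspose_mul, mul_assoc]

theorem heis_smul (c : ℂ) (B A : QOp N) : heis B (c • A) = c • heis B A := by
  simp [heis]

theorem heis_isHermitian (B : QOp N) {A : QOp N} (hA : A.IsHermitian) : (heis B A).IsHermitian := by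
  unfold heis Matrix.IsHermitian
  simp only [Matrix.conjTranspose_mul, hA.eq, Matrix.conjTranspose_conjTranspose, mul_assoc]

namespace PauliString

theorem heis_toOp (S P : PauliString N) : heis S.toOp P.toOp = ((sign P S : ℝ) : ℂ) • P.toOp := by
  rw [heis, S.toOp_isHermitian.eq, mul_assoc, toOp_mul_comm, Matrix.mul_smul, ← mul_assoc,
    toOp_mul_self, one_mul]
  simp

theorem coeff_heis_toOp (S Q : PauliString N) (A : QOp N) :
    coeff Q (heis S.toOp A) = sign Q S * coeff Q A := by
  have : (Q.toOp * heis S.toOp A).trace = ((sign Q S : ℝ) : ℂ) * (Q.toOp * A).trace := by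
    calc _ = (heis S.toOp Q.toOp * A).trace := by
          simp only [heis, S.toOp_isHermitian.eq]
          rw [← mul_assoc, ← mul_assoc, Matrix.trace_mul_comm]
          simp only [mul_assoc]
      _ = _ := by rw [heis_toOp, Matrix.smul_mul, Matrix.trace_smul, smul_eq_mul]
  rw [coeff, this, Complex.re_ofReal_mul, coeff]; ring

theorem coeff_heis (B : QOp N) {A : QOp N} (hA : A.IsHermitian) (Q : PauliString N) :
    coeff Q (heis B A) = ∑ P, coeff P A * coeff Q (heis B P.toOp) := by
  conv_lhs => rw [← sum_coeff_smul_toOp hA]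
  rw [heis, Matrix.mul_sum, Finset.sum_mul, coeff_sum]
  refine Finset.sum_congr rfl fun P _ => ?_
  rw [← coeff_real_smul, ← heis_smul, heis]

variable (s : Finset (Fin N))

theorem heis_embedOp_of_trivial {P : PauliString N} (hP : ∀ q ∈ s, P q = .I)
    (V : Matrix.unitaryGroup (s → Fin 2) ℂ) : heis (embedOp s V) P.toOp = P.toOp := by
  rw [heis, mul_assoc, toOp_commute_embedOp s hP, ← mul_assoc, embedOp_unitary, one_mul]

/-- Conjugation by a Pauli at `q` commutes with the evolution. It scales the coefficient by the sign
of `P` on one side and by that of `Q` on the other, and a Pauli at `q` separates the two. -/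
theorem coeff_heis_eq_zero {P Q : PauliString N} {q : Fin N} (hq : q ∉ s) (h : P q ≠ Q q)
    (V : Matrix (s → Fin 2) (s → Fin 2) ℂ) : coeff Q (heis (embedOp s V) P.toOp) = 0 := by
  obtain ⟨t, ht⟩ := Pauli.exists_sign_ne h
  have hS : ∀ i ∈ s, single q t i = .I := fun i hi => by
    simp [single, ne_of_mem_of_not_mem hi hq]
  have h1 := coeff_heis_toOp (single q t) Q (heis (embedOp s V) P.toOp)
  rw [← heis_mul, ← toOp_commute_embedOp s hS, heis_mul, heis_toOp, heis_smul, coeff_real_smul,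
    sign_single, sign_single, ← sub_eq_zero, ← sub_mul, mul_eq_zero] at h1
  exact h1.resolve_left fun h2 => ht (by exact_mod_cast sub_eq_zero.mp h2)

/-- `Q` commutes with the local unitary, so the evolution drops out of the trace and orthogonality
of strings applies. -/
theorem coeff_heis_eq_zero_of_trivial {P Q : PauliString N} (hQ : ∀ q ∈ s, Q q = .I) (h : P ≠ Q)
    (V : Matrix.unitaryGroup (s → Fin 2) ℂ) : coeff Q (heis (embedOp s V) P.toOp) = 0 := by
  have : (Q.toOp * heis (embedOp s V) P.toOp).trace = (Q.toOp * P.toOp).trace := by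
    rw [heis, ← mul_assoc, ← mul_assoc, ← embedOp_conjTranspose, toOp_commute_embedOp s hQ,
      Matrix.trace_mul_comm, ← mul_assoc, ← mul_assoc, embedOp_conjTranspose, embedOp_unitary',
      one_mul]
  rw [coeff, this, trace_toOp_mul_toOp, if_neg (Ne.symm h)]; simp

/-- Strings living on `s` are themselves local unitaries; inserting them into the Haar integral
produces the selection rules below. -/
theorem exists_unitary_eq_toOp {S : PauliString N} (hS : ∀ q ∉ s, S q = .I) :
    ∃ u : Matrix.unitaryGroup (s → Fin 2) ℂ, embedOp s u = S.toOp :=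
  ⟨⟨S.localOp s, mem_unitaryGroup_of_embedOp s (by
    rw [embedOp_localOp s hS, S.toOp_isHermitian.eq, toOp_mul_self])⟩, embedOp_localOp s hS⟩

theorem continuous_coeff (Q : PauliString N) : Continuous (coeff Q) := by
  unfold coeff
  fun_prop

theorem continuous_heis_embedOp (A : QOp N) : Continuous fun W : Matrix.unitaryGroup (s → Fin 2) ℂ =>
    heis (embedOp s W) A := by
  have : Continuous fun W : Matrix.unitaryGroup (s → Fin 2) ℂ =>
    embedOp s (W : Matrix (s → Fin 2) (s → Fin 2) ℂ) :=
    (continuous_embedOp s).comp continuous_subtype_val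
  unfold heis
  fun_prop

/-- Haar second moments of the Pauli coefficients of evolved Pauli strings. -/
noncomputable def twirl (P P' Q Q' : PauliString N) : ℝ :=
  ∫ W, coeff Q (heis (embedOp s (W : Matrix (s → Fin 2) (s → Fin 2) ℂ)) P.toOp) *
    coeff Q' (heis (embedOp s W) P'.toOp) ∂(haarUnitary (s → Fin 2))

theorem integrable_coeff_mul_coeff (A A' : QOp N) (Q Q' : PauliString N) :
    Integrable (fun W : Matrix.unitaryGroup (s → Fin 2) ℂ =>
      coeff Q (heis (embedOp s (W : Matrix (s → Fin 2) (s → Fin 2) ℂ)) A) *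
      coeff Q' (heis (embedOp s W) A')) (haarUnitary (s → Fin 2)) :=
  integrable_haarUnitary _ (((continuous_coeff Q).comp (continuous_heis_embedOp s A)).mul
    ((continuous_coeff Q').comp (continuous_heis_embedOp s A')))

theorem sum_coeff_mul_twirl {A : QOp N} (hA : A.IsHermitian) (Q Q' : PauliString N) :
    ∑ P, ∑ P', coeff P A * coeff P' A * twirl s P P' Q Q' =
      ∫ W, coeff Q (heis (embedOp s (W : Matrix (s → Fin 2) (s → Fin 2) ℂ)) A) *
        coeff Q' (heis (embedOp s W) A) ∂(haarUnitary (s → Fin 2)) := by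
  simp only [coeff_heis _ hA, Finset.sum_mul_sum, twirl]
  have hi : ∀ P P', Integrable (fun W : Matrix.unitaryGroup (s → Fin 2) ℂ =>
      coeff P A * coeff Q (heis (embedOp s (W : Matrix (s → Fin 2) (s → Fin 2) ℂ)) P.toOp) *
      (coeff P' A * coeff Q' (heis (embedOp s W) P'.toOp))) (haarUnitary (s → Fin 2)) :=
    fun P P' => by
      convert (integrable_coeff_mul_coeff s P.toOp P'.toOp Q Q').const_mul
        (coeff P A * coeff P' A) using 2
      ring
  rw [integral_finsetSum _ fun P _ => integrable_finsetSum _ fun P' _ => hi P P']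
  refine Finset.sum_congr rfl fun P _ => ?_
  rw [integral_finsetSum _ fun P' _ => hi P P']
  refine Finset.sum_congr rfl fun P' _ => ?_
  rw [← integral_const_mul]
  exact integral_congr_ae (.of_forall fun W => by ring)

/-- Haar moments absorb local unitaries. -/
theorem sum_coeff_heis_mul_twirl {A : QOp N} (hA : A.IsHermitian) (Q Q' : PauliString N)
    (u : Matrix.unitaryGroup (s → Fin 2) ℂ) :
    ∑ P, ∑ P', coeff P (heis (embedOp s u) A) * coeff P' (heis (embedOp s u) A) * twirl s P P' Q Q' =
      ∑ P, ∑ P', coeff P A * coeff P' A * twirl s P P' Q Q' := by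
  rw [sum_coeff_mul_twirl s hA, sum_coeff_mul_twirl s (heis_isHermitian _ hA)]
  have h := integral_mul_left_eq_self (μ := haarUnitary (s → Fin 2))
    (fun W => coeff Q (heis (embedOp s (W : Matrix (s → Fin 2) (s → Fin 2) ℂ)) A) *
      coeff Q' (heis (embedOp s W) A)) u
  simpa only [← heis_mul, ← embedOp_mul, Submonoid.coe_mul] using h

theorem twirl_eq_right (P P' Q Q' : PauliString N) (u : Matrix.unitaryGroup (s → Fin 2) ℂ) :
    twirl s P P' Q Q' =
      ∫ W, coeff Q (heis (embedOp s u) (heis (embedOp s (W : Matrix (s → Fin 2) (s → Fin 2) ℂ)) P.toOp))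
        * coeff Q' (heis (embedOp s u) (heis (embedOp s W) P'.toOp)) ∂(haarUnitary (s → Fin 2)) := by
  rw [twirl, ← integral_mul_right_eq_self _ u]
  simp only [← heis_mul, ← embedOp_mul, Submonoid.coe_mul]

theorem twirl_eq_left (P P' Q Q' : PauliString N) (u : Matrix.unitaryGroup (s → Fin 2) ℂ) :
    twirl s P P' Q Q' =
      ∫ W, coeff Q (heis (embedOp s (W : Matrix (s → Fin 2) (s → Fin 2) ℂ)) (heis (embedOp s u) P.toOp))
        * coeff Q' (heis (embedOp s W) (heis (embedOp s u) P'.toOp)) ∂(haarUnitary (s → Fin 2)) := by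
  rw [twirl, ← integral_mul_left_eq_self _ u]
  simp only [← heis_mul, ← embedOp_mul, Submonoid.coe_mul]

theorem sign_mul_sign_of_ne {p q t : Pauli} (h : p.sign t ≠ q.sign t) :
    (p.sign t : ℝ) * (q.sign t : ℝ) = -1 := by
  rcases Pauli.sign_eq_or p t with h1 | h1 <;> rcases Pauli.sign_eq_or q t with h2 | h2 <;>
    simp_all

theorem single_of_notMem {q : Fin N} (hq : q ∈ s) (t : Pauli) : ∀ i ∉ s, single q t i = .I :=
  fun i hi => by simp [single, (ne_of_mem_of_not_mem hq hi).symm]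

/-- Right translation by a Pauli at `q` that separates `Q` from `Q'` multiplies the integral by
`-1`. -/
theorem twirl_eq_zero_of_ne_right {P P' Q Q' : PauliString N} {q : Fin N} (hq : q ∈ s)
    (h : Q q ≠ Q' q) : twirl s P P' Q Q' = 0 := by
  obtain ⟨t, ht⟩ := Pauli.exists_sign_ne h
  obtain ⟨u, hu⟩ := exists_unitary_eq_toOp s (single_of_notMem s hq t)
  have h1 := twirl_eq_right s P P' Q Q' u
  simp only [hu, coeff_heis_toOp, sign_single] at h1
  simp only [mul_mul_mul_comm _ (coeff Q _), sign_mul_sign_of_ne ht, neg_mul, one_mul,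
    integral_neg] at h1
  rw [← twirl] at h1
  linarith

/-- Left translation gives the same sign argument for the input strings. -/
theorem twirl_eq_zero_of_ne_left {P P' Q Q' : PauliString N} {q : Fin N} (hq : q ∈ s)
    (h : P q ≠ P' q) : twirl s P P' Q Q' = 0 := by
  obtain ⟨t, ht⟩ := Pauli.exists_sign_ne h
  obtain ⟨u, hu⟩ := exists_unitary_eq_toOp s (single_of_notMem s hq t)
  have h1 := twirl_eq_left s P P' Q Q' u
  simp only [hu, heis_toOp, heis_smul, coeff_real_smul, sign_single] at h1
  simp only [mul_mul_mul_comm _ (coeff Q _), sign_mul_sign_of_ne ht, neg_mul, one_mul,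
    integral_neg] at h1
  rw [← twirl] at h1
  linarith

theorem twirl_eq_zero_of_outside {P P' Q Q' : PauliString N} {q : Fin N} (hq : q ∉ s)
    (h : P q ≠ Q q ∨ P' q ≠ Q' q) : twirl s P P' Q Q' = 0 := by
  rw [twirl, ← integral_zero (Matrix.unitaryGroup (s → Fin 2) ℂ) ℝ (μ := haarUnitary (s → Fin 2))]
  refine integral_congr_ae (.of_forall fun W => ?_)
  rcases h with h | h
  · simp [coeff_heis_eq_zero s hq h]
  · simp [coeff_heis_eq_zero s hq h]

theorem twirl_diag_eq_zero {P P' Q : PauliString N} (h : P ≠ P') : twirl s P P' Q Q = 0 := by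
  obtain ⟨q, hq⟩ := Function.ne_iff.mp h
  by_cases hs : q ∈ s
  · exact twirl_eq_zero_of_ne_left s hs hq
  · exact twirl_eq_zero_of_outside s hs (by by_contra! h2; exact hq (h2.1.trans h2.2.symm))

theorem twirl_diag_nonneg (P Q : PauliString N) : 0 ≤ twirl s P P Q Q :=
  integral_nonneg fun _ => mul_self_nonneg _

theorem twirl_of_trivial {P : PauliString N} (hP : ∀ q ∈ s, P q = .I) : twirl s P P P P = 1 := by
  simp [twirl, heis_embedOp_of_trivial s hP, coeff_toOp]

/-- The restriction of a string to the qubits in `s`. -/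
def restrict (P : PauliString N) : PauliString N := fun q => if q ∈ s then P q else .I

theorem restrict_mul_restrict_compl (P : PauliString N) :
    mul (restrict s P) (restrict sᶜ P) = P := by
  funext q
  by_cases hq : q ∈ s
  · simp [mul, restrict, hq, Pauli.mul_I]
  · simp [mul, restrict, hq, Pauli.mul]

theorem phase_eq_one {T R : PauliString N} (hT : ∀ q ∉ s, T q = .I) (hR : ∀ q ∈ s, R q = .I) :
    phase T R = 1 := by
  refine Finset.prod_eq_one fun q _ => ?_
  by_cases hq : q ∈ s
  · rw [hR q hq]; cases T q <;> rfl
  · rw [hT q hq]; cases R q <;> rfl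

/-- Anticommuting Pauli strings are conjugate under a local unitary. -/
theorem twirl_eq_of_anticommute {T T' R : PauliString N} (hT : ∀ q ∉ s, T q = .I)
    (hT' : ∀ q ∉ s, T' q = .I) (hR : ∀ q ∈ s, R q = .I) (h : sign T T' = -1) (P : PauliString N) :
    twirl s P P (mul T R) (mul T R) = twirl s P P (mul T' R) (mul T' R) := by
  have hc : ((√2 : ℝ) : ℂ)⁻¹ * ((√2 : ℝ) : ℂ)⁻¹ = 2⁻¹ := by
    rw [← mul_inv, ← Complex.ofReal_mul, Real.mul_self_sqrt zero_le_two]; simp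
  have hTT : T.toOp * T'.toOp = -(T'.toOp * T.toOp) := by rw [toOp_mul_comm, h]; simp
  -- A Hadamard-like unitary: for anticommuting `T` and `T'`, the operator `(T + T') / √2` is
  -- Hermitian, squares to 1 and conjugates `T` into `T'`.
  set v : Matrix (s → Fin 2) (s → Fin 2) ℂ :=
    ((√2 : ℝ) : ℂ)⁻¹ • (T.localOp s + T'.localOp s) with hv
  have hE : embedOp s v = ((√2 : ℝ) : ℂ)⁻¹ • (T.toOp + T'.toOp) := by
    rw [hv, embedOp_smul, embedOp_add, embedOp_localOp s hT, embedOp_localOp s hT']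
  have hH : (embedOp s v).conjTranspose = embedOp s v := by
    rw [hE, Matrix.conjTranspose_smul, Matrix.conjTranspose_add, T.toOp_isHermitian.eq,
      T'.toOp_isHermitian.eq]
    simp
  have hconj : embedOp s v * T.toOp * embedOp s v = T'.toOp := by
    rw [hE, Matrix.smul_mul, Matrix.smul_mul, Matrix.mul_smul, smul_smul, hc]
    have : (T.toOp + T'.toOp) * T.toOp * (T.toOp + T'.toOp) = (2 : ℂ) • T'.toOp := by
      rw [add_mul, toOp_mul_self, mul_add, add_mul, add_mul, one_mul, one_mul, mul_assoc,
        toOp_mul_self, mul_one, mul_assoc, hTT, mul_neg, ← mul_assoc, toOp_mul_self, one_mul,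
        two_smul]
      abel
    rw [this, smul_smul]; norm_num
  have hU : (embedOp s v).conjTranspose * embedOp s v = 1 := by
    rw [hH, hE, Matrix.smul_mul, Matrix.mul_smul, smul_smul, hc, add_mul, mul_add, mul_add,
      toOp_mul_self, toOp_mul_self, hTT]
    have : (1 : QOp N) + -(T'.toOp * T.toOp) + (T'.toOp * T.toOp + 1) = (2 : ℂ) • 1 := by
      rw [two_smul]; abel
    rw [this, smul_smul]; norm_num
  have hfull : embedOp s v * (mul T R).toOp * embedOp s v = (mul T' R).toOp := by
    have h1 : ∀ S : PauliString N, (∀ q ∉ s, S q = .I) → (mul S R).toOp = S.toOp * R.toOp :=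
      fun S hS => by rw [toOp_mul, phase_eq_one s hS hR, one_smul]
    rw [h1 T hT, h1 T' hT', ← hconj]
    simp only [mul_assoc]
    rw [toOp_commute_embedOp s hR]
  have hcoeff : ∀ A : QOp N, coeff (mul T R) (heis (embedOp s v) A) = coeff (mul T' R) A := fun A => by
    rw [coeff, coeff, ← hfull, heis, hH, ← mul_assoc, ← mul_assoc, Matrix.trace_mul_comm]
    simp only [mul_assoc]
  rw [twirl_eq_right s P P _ _ ⟨v, mem_unitaryGroup_of_embedOp s hU⟩]
  simp only [hcoeff]
  rfl

/-- If both strings are non-trivial at a common one of the chosen qubits, one Pauli there suffices.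
Otherwise take one letter at `i` and one at `j`; each string sees only one of them. -/
theorem exists_anticommute_both {T T' : PauliString N} (hT : ∀ q ∉ s, T q = .I)
    (hT' : ∀ q ∉ s, T' q = .I) (h : ∃ q, T q ≠ .I) (h' : ∃ q, T' q ≠ .I) :
    ∃ S : PauliString N, (∀ q ∉ s, S q = .I) ∧ sign T S = -1 ∧ sign T' S = -1 := by
  obtain ⟨i, hi⟩ := h
  obtain ⟨j, hj⟩ := h'
  have his : i ∈ s := by by_contra hh; exact hi (hT i hh)
  have hjs : j ∈ s := by by_contra hh; exact hj (hT' j hh)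
  by_cases h1 : T' i = .I
  · by_cases h2 : T j = .I
    · obtain ⟨t, ht⟩ := Pauli.exists_sign_neg hi
      obtain ⟨t', ht'⟩ := Pauli.exists_sign_neg hj
      have hI : ∀ t, Pauli.sign .I t = 1 := fun t => by cases t <;> rfl
      refine ⟨mul (single i t) (single j t'), fun q hq => ?_, ?_, ?_⟩
      · simp [mul, single_of_notMem s his t q hq, single_of_notMem s hjs t' q hq, Pauli.mul]
      · rw [sign_comm, sign_mul_left, sign_comm, sign_comm _ T, sign_single, sign_single, ht, h2, hI]
        rfl
      · rw [sign_comm, sign_mul_left, sign_comm, sign_comm _ T', sign_single, sign_single, ht', h1,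
          hI]
        rfl
    · obtain ⟨t, ht, ht'⟩ := Pauli.exists_sign_neg_both h2 hj
      exact ⟨single j t, single_of_notMem s hjs t, by rw [sign_single, ht], by rw [sign_single, ht']⟩
  · obtain ⟨t, ht, ht'⟩ := Pauli.exists_sign_neg_both hi h1
    exact ⟨single i t, single_of_notMem s his t, by rw [sign_single, ht], by rw [sign_single, ht']⟩

/-- The parts on `s` need not anticommute with each other, so the comparison passes through a third
string that anticommutes with both. -/
theorem twirl_diag_congr (P : PauliString N) {Q Q' : PauliString N} (h : ∀ q ∉ s, Q q = Q' q)
    (hQ : ∃ q ∈ s, Q q ≠ .I) (hQ' : ∃ q ∈ s, Q' q ≠ .I) :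
    twirl s P P Q Q = twirl s P P Q' Q' := by
  have hr : ∀ P : PauliString N, ∀ q ∉ s, restrict s P q = .I := fun P q hq => by
    simp [restrict, hq]
  have hne : ∀ P : PauliString N, (∃ q ∈ s, P q ≠ .I) → ∃ q, restrict s P q ≠ .I :=
    fun P ⟨q, hq, h⟩ => ⟨q, by simpa [restrict, hq] using h⟩
  have hR : ∀ q ∈ s, restrict sᶜ Q q = .I := fun q hq => by simp [restrict, hq]
  obtain ⟨S, hS, h1, h2⟩ := exists_anticommute_both s (hr Q) (hr Q') (hne Q hQ) (hne Q' hQ')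
  have hRR : restrict sᶜ Q = restrict sᶜ Q' := by
    funext q
    by_cases hq : q ∈ s
    · simp [restrict, hq]
    · simp [restrict, hq, h q hq]
  have e1 := twirl_eq_of_anticommute s (hr Q) hS hR h1 P
  have e2 := twirl_eq_of_anticommute s (hr Q') hS hR h2 P
  rw [restrict_mul_restrict_compl] at e1
  rw [hRR, restrict_mul_restrict_compl] at e2
  rw [e1, hRR, e2]

/-- The Pauli strings that agree with `P` outside of `s`. -/
def agreeOutside (P : PauliString N) : Finset (PauliString N) :=
  Fintype.piFinset fun q => if q ∈ s then Finset.univ else {P q}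

theorem mem_agreeOutside {P Q : PauliString N} :
    Q ∈ agreeOutside s P ↔ ∀ q ∉ s, Q q = P q := by
  simp only [agreeOutside, Fintype.mem_piFinset]
  refine forall_congr' fun q => ?_
  by_cases hq : q ∈ s <;> simp [hq]

theorem card_agreeOutside (P : PauliString N) : (agreeOutside s P).card = 4 ^ s.card := by
  rw [agreeOutside, Fintype.card_piFinset]
  have : ∀ q, (if q ∈ s then (Finset.univ : Finset Pauli) else {P q}).card
      = if q ∈ s then 4 else 1 := fun q => by split_ifs <;> rfl
  simp only [this, Finset.prod_ite_mem, Finset.univ_inter, Finset.prod_const]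

/-- Diagonal moments sum to 1 by Parseval. They vanish off the `4 ^ |s|` strings agreeing with `P`
outside `s`, and also at the one that is trivial on `s`. The others share one value, which is
therefore at least `4 ^ (-|s|)`. -/
theorem inv_le_twirl {P Q : PauliString N} (h : ∀ q ∉ s, Q q = P q)
    (hP : ∃ q ∈ s, P q ≠ .I) (hQ : ∃ q ∈ s, Q q ≠ .I) :
    ((4 : ℝ) ^ s.card)⁻¹ ≤ twirl s P P Q Q := by
  have h1 : ∑ Q', twirl s P P Q' Q' = 1 := by
    simp only [twirl]
    rw [← integral_finsetSum _ fun Q' _ => integrable_coeff_mul_coeff s P.toOp P.toOp Q' Q']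
    have : ∀ W : Matrix.unitaryGroup (s → Fin 2) ℂ, ∑ Q', coeff Q' (heis (embedOp s W) P.toOp) *
        coeff Q' (heis (embedOp s W) P.toOp) = 1 := fun W => by
      simp only [← pow_two]
      refine sum_coeff_sq (heis_isHermitian _ P.toOp_isHermitian) ?_
      calc heis (embedOp s W) P.toOp * heis (embedOp s W) P.toOp
          = (embedOp s (W : Matrix (s → Fin 2) (s → Fin 2) ℂ)).conjTranspose * (P.toOp *
            (embedOp s W * (embedOp s (W : Matrix (s → Fin 2) (s → Fin 2) ℂ)).conjTranspose)
            * P.toOp) * embedOp s W := by simp only [heis, mul_assoc]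
        _ = 1 := by rw [embedOp_unitary', mul_one, toOp_mul_self, mul_one, embedOp_unitary]
    simp [this]
  have h2 : ∀ Q', twirl s P P Q' Q' ≤ if Q' ∈ agreeOutside s P then twirl s P P Q Q else 0 := by
    intro Q'
    split_ifs with hm
    · rw [mem_agreeOutside] at hm
      by_cases hQ' : ∃ q ∈ s, Q' q ≠ .I
      · exact (twirl_diag_congr s P (fun q hq => (hm q hq).trans (h q hq).symm) hQ' hQ).le
      · push Not at hQ'
        have hne : P ≠ Q' := by
          rintro rfl
          obtain ⟨q, hq, hqq⟩ := hP
          exact hqq (hQ' q hq)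
        have : twirl s P P Q' Q' = 0 := by
          simp [twirl, coeff_heis_eq_zero_of_trivial s hQ' hne]
        rw [this]; exact twirl_diag_nonneg s P Q
    · rw [mem_agreeOutside] at hm
      push Not at hm
      obtain ⟨q, hq, hqq⟩ := hm
      exact (twirl_eq_zero_of_outside s hq (.inl hqq.symm)).le
  have h3 := Finset.sum_le_sum fun Q' (_ : Q' ∈ Finset.univ) => h2 Q'
  rw [h1, Finset.sum_ite_mem, Finset.univ_inter, Finset.sum_const, card_agreeOutside,
    nsmul_eq_mul] at h3
  push_cast at h3
  rw [inv_le_iff_one_le_mul₀ (by positivity)]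
  linarith

end PauliString

end Heisenberg

/-! ### Random operators -/

instance instBorelSpaceComplexMatrix (m n : Type*) [Countable m] [Countable n] :
    BorelSpace (Matrix m n ℂ) := inferInstanceAs (BorelSpace (m → n → ℂ))

instance instSecondCountableComplexMatrix (m n : Type*) [Countable m] [Countable n] :
    SecondCountableTopology (Matrix m n ℂ) :=
  inferInstanceAs (SecondCountableTopology (m → n → ℂ))

/-! ### From 2-designs to Haar moments -/

section Design

open PauliString

variable {N : ℕ} {Θ : Type*} [MeasurableSpace Θ] (s : Finset (Fin N))

/-- The coefficients of `coeff Q (heis (embedOp s V) A)` as a polynomial in the entries. -/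
noncomputable def heisCoeffPoly (Q : PauliString N) (A : QOp N)
    (τ : ((s → Fin 2) × (s → Fin 2)) × ((s → Fin 2) × (s → Fin 2))) : ℂ :=
  (2 ^ N : ℂ)⁻¹ * (Q.toOp * (embedOp s (Matrix.single τ.2.1 τ.2.2 1) * A *
    embedOp s (Matrix.single τ.1.1 τ.1.2 1))).trace

/-- The coefficient has degree one in the entries of `V` and one in those of `V†`, so products of
two coefficients are exactly what a 2-design averages correctly. -/
theorem ofReal_coeff_heis (V : Matrix (s → Fin 2) (s → Fin 2) ℂ) (Q : PauliString N) {A : QOp N}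
    (hA : A.IsHermitian) : (coeff Q (heis (embedOp s V) A) : ℂ) =
      ∑ τ, heisCoeffPoly s Q A τ * (V τ.1.1 τ.1.2 * V.conjTranspose τ.2.1 τ.2.2) := by
  rw [ofReal_coeff Q (heis_isHermitian _ hA), heis, ← embedOp_conjTranspose,
    embedOp_eq_sum s V.conjTranspose]
  conv_lhs => rw [embedOp_eq_sum s V]
  rw [Fintype.sum_prod_type, ← Fintype.sum_prod_type' (f := fun k l =>
    V.conjTranspose k l • embedOp s (Matrix.single k l 1)), ← Fintype.sum_prod_type' (f := fun k l =>
    V k l • embedOp s (Matrix.single k l 1)), Matrix.mul_sum, Matrix.mul_sum, Matrix.trace_sum,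
    Finset.mul_sum]
  refine Finset.sum_congr rfl fun a _ => ?_
  rw [Finset.sum_mul, Finset.sum_mul, Matrix.mul_sum, Matrix.trace_sum, Finset.mul_sum]
  refine Finset.sum_congr rfl fun b _ => ?_
  simp only [Matrix.smul_mul, Matrix.mul_smul, Matrix.trace_smul, smul_eq_mul, heisCoeffPoly]
  ring

variable {s}

theorem ofReal_integral_coeff_mul_coeff {μ : Measure Θ} [IsProbabilityMeasure μ]
    {V : Θ → Matrix.unitaryGroup (s → Fin 2) ℂ} (hV : Measurable V) (Q Q' : PauliString N)
    {A A' : QOp N} (hA : A.IsHermitian) (hA' : A'.IsHermitian) :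
    ((∫ θ, coeff Q (heis (embedOp s (V θ)) A) * coeff Q' (heis (embedOp s (V θ)) A') ∂μ : ℝ) : ℂ) =
      ∑ τ, ∑ τ', heisCoeffPoly s Q A τ * heisCoeffPoly s Q' A' τ' *
        ∫ θ, ∏ a : Fin 2, ((V θ : Matrix _ _ ℂ) (![τ.1.1, τ'.1.1] a) (![τ.1.2, τ'.1.2] a) *
          (V θ : Matrix _ _ ℂ).conjTranspose (![τ.2.1, τ'.2.1] a) (![τ.2.2, τ'.2.2] a)) ∂μ := by
  have he : ∀ i j, Measurable fun θ => (V θ : Matrix (s → Fin 2) (s → Fin 2) ℂ) i j := fun i j => by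
    have : Continuous fun W : Matrix.unitaryGroup (s → Fin 2) ℂ =>
      (W : Matrix (s → Fin 2) (s → Fin 2) ℂ) i j := continuous_subtype_val.matrix_elem i j
    exact this.measurable.comp hV
  have hint : ∀ i j k l : Fin 2 → (s → Fin 2), Integrable (fun θ => ∏ a : Fin 2,
      ((V θ : Matrix _ _ ℂ) (i a) (j a) * (V θ : Matrix _ _ ℂ).conjTranspose (k a) (l a))) μ := by
    intro i j k l
    refine Integrable.of_bound (C := 1) ?_ (.of_forall fun θ => ?_)
    · simp only [Matrix.conjTranspose_apply]
      refine Measurable.aestronglyMeasurable (Finset.measurable_fun_prod _ fun a _ => ?_)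
      exact (he _ _).mul (continuous_star.measurable.comp (he _ _))
    · rw [norm_prod]
      refine Finset.prod_le_one (fun _ _ => norm_nonneg _) fun a _ => ?_
      rw [norm_mul, Matrix.conjTranspose_apply, norm_star]
      exact mul_le_one₀ (entry_norm_bound_of_unitary (V θ).2 _ _) (norm_nonneg _)
        (entry_norm_bound_of_unitary (V θ).2 _ _)
  refine integral_complex_ofReal.symm.trans ?_
  simp only [Complex.ofReal_mul, ofReal_coeff_heis s _ _ hA, ofReal_coeff_heis s _ _ hA',
    Finset.sum_mul_sum]
  have hrw : ∀ τ τ' θ, heisCoeffPoly s Q A τ * ((V θ : Matrix _ _ ℂ) τ.1.1 τ.1.2 *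
      (V θ : Matrix _ _ ℂ).conjTranspose τ.2.1 τ.2.2) * (heisCoeffPoly s Q' A' τ' *
      ((V θ : Matrix _ _ ℂ) τ'.1.1 τ'.1.2 * (V θ : Matrix _ _ ℂ).conjTranspose τ'.2.1 τ'.2.2)) =
      heisCoeffPoly s Q A τ * heisCoeffPoly s Q' A' τ' * ∏ a : Fin 2,
        ((V θ : Matrix _ _ ℂ) (![τ.1.1, τ'.1.1] a) (![τ.1.2, τ'.1.2] a) *
          (V θ : Matrix _ _ ℂ).conjTranspose (![τ.2.1, τ'.2.1] a) (![τ.2.2, τ'.2.2] a)) :=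
    fun τ τ' θ => by simp only [Fin.prod_univ_two, Matrix.cons_val_zero, Matrix.cons_val_one]; ring
  simp only [hrw]
  rw [integral_finsetSum _ fun τ _ => integrable_finsetSum _ fun τ' _ => (hint _ _ _ _).const_mul _]
  refine Finset.sum_congr rfl fun τ _ => ?_
  rw [integral_finsetSum _ fun τ' _ => (hint _ _ _ _).const_mul _]
  exact Finset.sum_congr rfl fun τ' _ => integral_const_mul _ _

theorem IsLocalDesign.integral_coeff_mul_coeff {μ : Measure Θ} [IsProbabilityMeasure μ]
    {B : Θ → QOp N} (hB : IsLocalDesign 2 μ s B) (P P' Q Q' : PauliString N) :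
    ∫ θ, coeff Q (heis (B θ) P.toOp) * coeff Q' (heis (B θ) P'.toOp) ∂μ = twirl s P P' Q Q' := by
  obtain ⟨V, hV, hBV, hd⟩ := hB
  simp only [hBV]
  apply Complex.ofReal_injective
  rw [ofReal_integral_coeff_mul_coeff hV Q Q' P.toOp_isHermitian P'.toOp_isHermitian, twirl,
    ofReal_integral_coeff_mul_coeff (V := fun W => W) measurable_id Q Q' P.toOp_isHermitian
      P'.toOp_isHermitian]
  refine Finset.sum_congr rfl fun τ _ => Finset.sum_congr rfl fun τ' _ => ?_
  rw [hd]

theorem IsLocalDesign.measurable {μ : Measure Θ} {t : ℕ} {B : Θ → QOp N}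
    (hB : IsLocalDesign t μ s B) : Measurable B := by
  obtain ⟨V, hV, hBV, -⟩ := hB
  have : B = fun θ => embedOp s (V θ) := funext hBV
  rw [this]
  have hc : Continuous fun W : Matrix.unitaryGroup (s → Fin 2) ℂ =>
    embedOp s (W : Matrix (s → Fin 2) (s → Fin 2) ℂ) :=
    (continuous_embedOp s).comp continuous_subtype_val
  exact hc.measurable.comp hV

end Design

/-! ### Random observables and the evolution of their moments -/

section Observables

open PauliString

variable {N : ℕ} {Θ : Type*}

/-- Pointwise unitarity of a random operator. -/
def IsRandomUnitary (B : Θ → QOp N) : Prop := ∀ θ, (B θ).conjTranspose * B θ = 1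

theorem IsLocalDesign.isRandomUnitary {s : Finset (Fin N)} {_ : MeasurableSpace Θ} {μ : Measure Θ}
    {t : ℕ} {B : Θ → QOp N} (hB : IsLocalDesign t μ s B) : IsRandomUnitary B := by
  obtain ⟨V, -, hBV, -⟩ := hB
  intro θ
  rw [hBV, embedOp_unitary]

/-- By Parseval, each squared coefficient is one term of a non-negative sum equal to 1. -/
theorem abs_coeff_heis_le_one {B : QOp N} (hB : B.conjTranspose * B = 1) (P Q : PauliString N) :
    |coeff Q (heis B P.toOp)| ≤ 1 := by
  have hB' : B * B.conjTranspose = 1 := mul_eq_one_comm.mp hB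
  have h := sum_coeff_sq (heis_isHermitian B P.toOp_isHermitian) (by
    calc heis B P.toOp * heis B P.toOp
        = B.conjTranspose * (P.toOp * (B * B.conjTranspose) * P.toOp) * B := by
          simp only [heis, mul_assoc]
      _ = 1 := by rw [hB', mul_one, toOp_mul_self, mul_one, hB])
  rw [← sq_le_one_iff_abs_le_one, ← h]
  exact Finset.single_le_sum (f := fun Q => coeff Q (heis B P.toOp) ^ 2)
    (fun _ _ => sq_nonneg _) (Finset.mem_univ Q)

theorem measurable_heis : Measurable fun p : QOp N × QOp N => heis p.1 p.2 := by
  have : Continuous fun p : QOp N × QOp N => heis p.1 p.2 := by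
    unfold heis; fun_prop
  exact this.measurable

theorem PauliString.measurable_coeff (Q : PauliString N) : Measurable (coeff Q) :=
  (continuous_coeff Q).measurable

theorem measurable_coeff_heis (Q : PauliString N) (A : QOp N) :
    Measurable fun B : QOp N => coeff Q (heis B A) := by
  have : Continuous fun B : QOp N => heis B A := by unfold heis; fun_prop
  have h : Continuous fun B : QOp N => coeff Q (heis B A) := (continuous_coeff Q).comp this
  exact h.measurable

/-- The commutator `i[P, A]` of an observable with a Pauli string. -/
noncomputable def pauliCommutator (P : PauliString N) (A : QOp N) : QOp N :=
  Complex.I • (P.toOp * A - A * P.toOp)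

theorem pauliCommutator_isHermitian (P : PauliString N) {A : QOp N} (hA : A.IsHermitian) :
    (pauliCommutator P A).IsHermitian := by
  unfold pauliCommutator Matrix.IsHermitian
  rw [Matrix.conjTranspose_smul, Matrix.conjTranspose_sub, Matrix.conjTranspose_mul,
    Matrix.conjTranspose_mul, hA.eq, P.toOp_isHermitian.eq, Complex.star_def, Complex.conj_I,
    neg_smul, ← smul_neg, neg_sub]

theorem measurable_pauliCommutator (P : PauliString N) : Measurable (pauliCommutator P) := by
  have : Continuous (pauliCommutator P) := by
    unfold pauliCommutator; fun_prop
  exact this.measurable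

/-- A bounded random Hermitian operator that is measurable with respect to `m`. -/
structure IsRandomObservable (m : MeasurableSpace Θ) (A : Θ → QOp N) : Prop where
  herm : ∀ θ, (A θ).IsHermitian
  meas : Measurable[m] A
  bdd : ∃ C, ∀ θ P, |coeff P (A θ)| ≤ C

namespace IsRandomObservable

variable {m mΘ : MeasurableSpace Θ} {A A' : Θ → QOp N}

theorem const (m : MeasurableSpace Θ) {A : QOp N} (hA : A.IsHermitian) :
    IsRandomObservable m fun _ : Θ => A where
  herm _ := hA
  meas := measurable_const
  bdd := ⟨∑ P, |coeff P A|, fun _ P => Finset.single_le_sum (f := fun P => |coeff P A|)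
    (fun _ _ => abs_nonneg _) (Finset.mem_univ P)⟩

theorem mono (hm : m ≤ mΘ) (hA : IsRandomObservable m A) : IsRandomObservable mΘ A :=
  ⟨hA.herm, hA.meas.mono hm le_rfl, hA.bdd⟩

theorem heis_of_measurable {B : Θ → QOp N} (hA : IsRandomObservable m A) (hB : Measurable[m] B)
    (hU : IsRandomUnitary B) : IsRandomObservable m fun θ => heis (B θ) (A θ) where
  herm θ := heis_isHermitian _ (hA.herm θ)
  meas := by
    have h : Measurable[m] fun θ => (B θ, A θ) := hB.prodMk hA.meas
    have h2 := measurable_heis.comp h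
    exact h2
  bdd := by
    obtain ⟨C, hC⟩ := hA.bdd
    refine ⟨∑ _P : PauliString N, C, fun θ Q => ?_⟩
    rw [coeff_heis (B θ) (hA.herm θ) Q]
    refine (Finset.abs_sum_le_sum_abs _ _).trans (Finset.sum_le_sum fun P _ => ?_)
    rw [abs_mul]
    exact (mul_le_of_le_one_right (abs_nonneg _) (abs_coeff_heis_le_one (hU θ) P Q)).trans (hC θ P)

theorem commutator (hA : IsRandomObservable m A) (P : PauliString N) :
    IsRandomObservable m fun θ => pauliCommutator P (A θ) where
  herm θ := pauliCommutator_isHermitian P (hA.herm θ)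
  meas := (measurable_pauliCommutator P).comp hA.meas
  bdd := by
    obtain ⟨C, hC⟩ := hA.bdd
    refine ⟨2 * C, fun θ Q => ?_⟩
    obtain ⟨η, hη, h⟩ := coeff_commutator P Q
    have h2 : |η| ≤ 2 := by
      refine abs_le_of_sq_le_sq ?_ zero_le_two
      rw [hη]; split_ifs <;> norm_num
    rw [pauliCommutator, h _ (hA.herm θ), abs_mul]
    exact mul_le_mul h2 (hC θ _) (abs_nonneg _) zero_le_two

theorem integrable_coeff (hA : IsRandomObservable mΘ A) (μ : Measure Θ) [IsFiniteMeasure μ]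
    (Q : PauliString N) : Integrable (fun θ => coeff Q (A θ)) μ := by
  obtain ⟨C, hC⟩ := hA.bdd
  exact Integrable.of_bound ((measurable_coeff Q).comp hA.meas).aestronglyMeasurable C
    (.of_forall fun θ => hC θ Q)

theorem integrable_coeff_mul (hA : IsRandomObservable mΘ A) (hA' : IsRandomObservable mΘ A')
    (μ : Measure Θ) [IsFiniteMeasure μ] (Q Q' : PauliString N) :
    Integrable (fun θ => coeff Q (A θ) * coeff Q' (A' θ)) μ := by
  obtain ⟨C, hC⟩ := hA.bdd
  exact (hA'.integrable_coeff μ Q').bdd_mul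
    ((measurable_coeff Q).comp hA.meas).aestronglyMeasurable (.of_forall fun θ => hC θ Q)

end IsRandomObservable

variable {mΘ : MeasurableSpace Θ}

/-- The second moments of the Pauli coefficients of a random operator. -/
noncomputable def secondMoment (μ : Measure Θ) (A : Θ → QOp N) (Q Q' : PauliString N) : ℝ :=
  ∫ θ, coeff Q (A θ) * coeff Q' (A θ) ∂μ

/-- The action of a local `2`-design on second moments. -/
noncomputable def twirlMoment (s : Finset (Fin N)) (M : PauliString N → PauliString N → ℝ)
    (Q Q' : PauliString N) : ℝ :=
  ∑ P, ∑ P', M P P' * twirl s P P' Q Q'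

variable {μ : Measure Θ} {s : Finset (Fin N)} {A B : Θ → QOp N}

theorem secondMoment_commutator (hA : IsRandomObservable mΘ A) (P : PauliString N) :
    ∃ η : PauliString N → ℝ, (∀ Q, η Q ^ 2 = if sign Q P = -1 then 4 else 0) ∧
      (∀ Q, ∫ θ, coeff Q (pauliCommutator P (A θ)) ∂μ = η Q * ∫ θ, coeff (mul Q P) (A θ) ∂μ) ∧
      ∀ Q Q', secondMoment μ (fun θ => pauliCommutator P (A θ)) Q Q' =
        η Q * η Q' * secondMoment μ A (mul Q P) (mul Q' P) := by
  choose η hη h using coeff_commutator P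
  refine ⟨η, hη, fun Q => ?_, fun Q Q' => ?_⟩
  · rw [← integral_const_mul]
    exact integral_congr_ae (.of_forall fun θ => h Q _ (hA.herm θ))
  · rw [secondMoment, secondMoment, ← integral_const_mul]
    refine integral_congr_ae (.of_forall fun θ => ?_)
    simp only [pauliCommutator, h _ _ (hA.herm θ)]
    ring

variable [IsProbabilityMeasure μ]

/-- The coefficients of the evolved operator are bilinear in those of `A` and those of the
conjugated strings; independence factors the expectation, and the design part is a Haar moment. -/
theorem secondMoment_heis (hA : IsRandomObservable mΘ A) (hB : IsLocalDesign 2 μ s B)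
    (hi : IndepFun A B μ) :
    secondMoment μ (fun θ => heis (B θ) (A θ)) = twirlMoment s (secondMoment μ A) := by
  funext Q Q'
  have hc : ∀ P : PauliString N, IsRandomObservable mΘ fun θ => heis (B θ) P.toOp := fun P =>
    (IsRandomObservable.const mΘ P.toOp_isHermitian).heis_of_measurable hB.measurable
      hB.isRandomUnitary
  have hind : ∀ P P' : PauliString N, IndepFun (fun θ => coeff P (A θ) * coeff P' (A θ))
      (fun θ => coeff Q (heis (B θ) P.toOp) * coeff Q' (heis (B θ) P'.toOp)) μ := fun P P' => by
    refine hi.comp (φ := fun A => coeff P A * coeff P' A)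
      (ψ := fun B => coeff Q (heis B P.toOp) * coeff Q' (heis B P'.toOp))
      ((measurable_coeff P).mul (measurable_coeff P')) ?_
    exact (measurable_coeff_heis Q P.toOp).mul (measurable_coeff_heis Q' P'.toOp)
  have hprod : ∀ P P' : PauliString N, Integrable (fun θ => coeff P (A θ) * coeff Q (heis (B θ) P.toOp) *
      (coeff P' (A θ) * coeff Q' (heis (B θ) P'.toOp))) μ := fun P P' => by
    have := (hind P P').integrable_mul (hA.integrable_coeff_mul hA μ P P')
      ((hc P).integrable_coeff_mul (hc P') μ Q Q')
    refine this.congr (.of_forall fun θ => ?_)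
    simp only [Pi.mul_apply]; ring
  simp only [secondMoment, twirlMoment, coeff_heis _ (hA.herm _), Finset.sum_mul_sum]
  rw [integral_finsetSum _ fun P _ => integrable_finsetSum _ fun P' _ => hprod P P']
  refine Finset.sum_congr rfl fun P _ => ?_
  rw [integral_finsetSum _ fun P' _ => hprod P P']
  refine Finset.sum_congr rfl fun P' _ => ?_
  rw [← hB.integral_coeff_mul_coeff P P' Q Q', ← (hind P P').integral_fun_mul_eq_mul_integral
    (hA.integrable_coeff_mul hA μ P P').aestronglyMeasurable
    ((hc P).integrable_coeff_mul (hc P') μ Q Q').aestronglyMeasurable]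
  exact integral_congr_ae (.of_forall fun θ => by ring)

/-- The second moments after a local `2`-design do not change under preceding local unitaries. -/
theorem twirlMoment_secondMoment_heis (hA : IsRandomObservable mΘ A) {u : Θ → Matrix.unitaryGroup (s → Fin 2) ℂ}
    (hB : ∀ θ, B θ = embedOp s (u θ)) (hBm : Measurable B) :
    twirlMoment s (secondMoment μ fun θ => heis (B θ) (A θ)) = twirlMoment s (secondMoment μ A) := by
  have hU : IsRandomUnitary B := fun θ => by rw [hB, embedOp_unitary]
  have key : ∀ {A : Θ → QOp N}, IsRandomObservable mΘ A → ∀ Q Q', twirlMoment s (secondMoment μ A) Q Q' =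
      ∫ θ, ∑ P, ∑ P', coeff P (A θ) * coeff P' (A θ) * twirl s P P' Q Q' ∂μ := fun hA Q Q' => by
    have hi := fun P P' => (hA.integrable_coeff_mul hA μ P P').mul_const (twirl s P P' Q Q')
    rw [integral_finsetSum _ fun P _ => integrable_finsetSum _ fun P' _ => hi P P']
    refine Finset.sum_congr rfl fun P _ => ?_
    rw [integral_finsetSum _ fun P' _ => hi P P']
    exact Finset.sum_congr rfl fun P' _ => (integral_mul_const _ _).symm
  funext Q Q'
  rw [key (hA.heis_of_measurable hBm hU), key hA]
  refine integral_congr_ae (.of_forall fun θ => ?_)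
  simp only [hB, sum_coeff_heis_mul_twirl s (hA.herm θ)]

/-- The mean of an evolved operator, for a local `2`-design. -/
theorem integral_coeff_heis_toOp_eq_zero (hB : IsLocalDesign 2 μ s B) {P Q : PauliString N}
    (hQ : ∃ q ∈ s, Q q ≠ .I) : ∫ θ, coeff Q (heis (B θ) P.toOp) ∂μ = 0 := by
  obtain ⟨q, hq, hqq⟩ := hQ
  -- The identity coefficient of the conjugated identity is 1, so this first moment is the cross
  -- moment of `Q` with the identity string, which differs from `Q` at `q ∈ s`.
  have h := hB.integral_coeff_mul_coeff P (fun _ => .I) Q (fun _ => .I)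
  rw [twirl_eq_zero_of_ne_right s hq hqq] at h
  have h1 : ∀ θ, coeff (fun _ => .I) (heis (B θ) (toOp (N := N) fun _ => .I)) = 1 := fun θ => by
    rw [toOp_one, heis, mul_one, hB.isRandomUnitary θ, ← toOp_one, coeff_toOp, if_pos rfl]
  simpa only [h1, mul_one] using h

theorem integral_coeff_heis (hA : IsRandomObservable mΘ A) (hB : Measurable B)
    (hU : IsRandomUnitary B) (hi : IndepFun A B μ) (Q : PauliString N) :
    ∫ θ, coeff Q (heis (B θ) (A θ)) ∂μ =
      ∑ P, (∫ θ, coeff P (A θ) ∂μ) * ∫ θ, coeff Q (heis (B θ) P.toOp) ∂μ := by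
  have hc : ∀ P : PauliString N, IsRandomObservable mΘ fun θ => heis (B θ) P.toOp := fun P =>
    (IsRandomObservable.const mΘ P.toOp_isHermitian).heis_of_measurable hB hU
  have hind : ∀ P : PauliString N, IndepFun (fun θ => coeff P (A θ)) (fun θ => coeff Q (heis (B θ) P.toOp)) μ :=
    fun P => hi.comp (ψ := fun B => coeff Q (heis B P.toOp)) (measurable_coeff P)
      (measurable_coeff_heis Q P.toOp)
  simp only [coeff_heis _ (hA.herm _)]
  have hint : ∀ P : PauliString N,
      Integrable (fun θ => coeff P (A θ) * coeff Q (heis (B θ) P.toOp)) μ := fun P =>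
    (hind P).integrable_mul (hA.integrable_coeff μ P) ((hc P).integrable_coeff μ Q)
  rw [integral_finsetSum _ fun P _ => hint P]
  exact Finset.sum_congr rfl fun P _ => (hind P).integral_fun_mul_eq_mul_integral
    (hA.integrable_coeff μ P).aestronglyMeasurable ((hc P).integrable_coeff μ Q).aestronglyMeasurable

end Observables

/-! ### Propagation of lower bounds on second moments -/

section MomentBound

open PauliString

variable {N : ℕ} (s : Finset (Fin N))

namespace PauliString

/-- The string in which the non-trivial entries on the qubits in `c` are replaced by `Z`. -/
def zify (c : Finset (Fin N)) (h : PauliString N) : PauliString N :=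
  fun q => if q ∈ c ∧ h q ≠ .I then .Z else h q

theorem zify_ne_I_iff (c : Finset (Fin N)) (h : PauliString N) (q : Fin N) :
    zify c h q ≠ .I ↔ h q ≠ .I := by
  unfold zify
  split_ifs with h1
  · simp [h1.2]
  · rfl

theorem zify_union_apply {c : Finset (Fin N)} (h : PauliString N) {q : Fin N} (hq : q ∉ s) :
    zify (c ∪ s) h q = zify c h q := by
  simp [zify, hq]

theorem exists_ne_I_of_anticommute {Ω R : PauliString N} (hΩ : ∀ q ∉ s, Ω q = .I)
    (h : sign R Ω = -1) : ∃ q ∈ s, R q ≠ .I := by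
  by_contra! h2
  have : sign R Ω = 1 := by
    refine Finset.prod_eq_one fun q _ => ?_
    by_cases hq : q ∈ s
    · rw [h2 q hq]; cases Ω q <;> rfl
    · rw [hΩ q hq, Pauli.sign_I]
  omega

/-- Half of the strings on `s` anticommute with a given non-trivial string on `s`. -/
theorem two_mul_card_anticommute {Ω : PauliString N} (hΩ : ∀ q ∉ s, Ω q = .I)
    (hne : ∃ q, Ω q ≠ .I) (P : PauliString N) :
    2 * ((agreeOutside s P).filter fun R => sign R Ω = -1).card = 4 ^ s.card := by
  obtain ⟨q, hq⟩ := hne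
  have hqs : q ∈ s := by by_contra hh; exact hq (hΩ q hh)
  obtain ⟨t, ht⟩ := Pauli.exists_sign_neg hq
  have hsign : ∀ R, sign (mul R (single q t)) Ω = -sign R Ω := fun R => by
    rw [sign_mul_left, sign_comm (single q t), sign_single, ht]; ring
  have hmem : ∀ R ∈ agreeOutside s P, mul R (single q t) ∈ agreeOutside s P := fun R hR => by
    rw [mem_agreeOutside] at hR ⊢
    intro i hi
    rw [mul, single_of_notMem s hqs t i hi, Pauli.mul_I, hR i hi]
  have hcard : ((agreeOutside s P).filter fun R => sign R Ω = -1).card =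
      ((agreeOutside s P).filter fun R => ¬ sign R Ω = -1).card := by
    -- Multiplication by a Pauli anticommuting with `Ω` at one qubit is an involution exchanging the
    -- two halves.
    refine Finset.card_nbij' (fun R => mul R (single q t)) (fun R => mul R (single q t)) ?_ ?_ ?_ ?_
    · intro R hR
      simp only [Finset.coe_filter, Set.mem_ofPred_eq] at hR ⊢
      exact ⟨hmem R hR.1, by rw [hsign, hR.2]; decide⟩
    · intro R hR
      simp only [Finset.coe_filter, Set.mem_ofPred_eq] at hR ⊢
      exact ⟨hmem R hR.1, by rw [hsign, (sign_eq_or R Ω).resolve_right hR.2]⟩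
    · exact fun R _ => mul_mul_cancel_right _ _
    · exact fun R _ => mul_mul_cancel_right _ _
  rw [← card_agreeOutside s P, ← Finset.card_filter_add_card_filter_not (s := agreeOutside s P)
    fun R => sign R Ω = -1, ← hcard, two_mul]

end PauliString

variable {s} {F : Finset (PauliString N)} {c : Finset (Fin N)} {w : PauliString N → ℝ}
  {M : PauliString N → PauliString N → ℝ}

/-- On `s` the twirl forces the outputs to agree; elsewhere it copies the letters of the inputs, so
earlier agreement persists. -/
theorem twirlMoment_ne_zero {Q Q' : PauliString N} (h : twirlMoment s M Q Q' ≠ 0)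
    (hM : ∀ P P', M P P' ≠ 0 → ∀ q ∈ c, P q = P' q) : ∀ q ∈ c ∪ s, Q q = Q' q := by
  obtain ⟨P, -, hP⟩ := Finset.exists_ne_zero_of_sum_ne_zero h
  obtain ⟨P', -, hP'⟩ := Finset.exists_ne_zero_of_sum_ne_zero hP
  have h1 := left_ne_zero_of_mul hP'
  have h2 := right_ne_zero_of_mul hP'
  intro q hq
  by_cases hs : q ∈ s
  · by_contra hne
    exact h2 (twirl_eq_zero_of_ne_right s hs hne)
  · have hc : q ∈ c := (Finset.mem_union.mp hq).resolve_right hs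
    by_contra hne
    refine h2 (twirl_eq_zero_of_outside s hs ?_)
    by_contra! h3
    exact hne (h3.1.symm.trans ((hM P P' h1 q hc).trans h3.2))

/-- Off-diagonal moments never feed the diagonal (`twirl_diag_eq_zero`), so diagonals evolve by a
non-negative kernel, here shifted onto the test function. -/
theorem sum_twirlMoment_diag_mul (s : Finset (Fin N)) (M : PauliString N → PauliString N → ℝ)
    (f : PauliString N → ℝ) : ∑ Q, twirlMoment s M Q Q * f Q =
      ∑ P, M P P * ∑ Q, twirl s P P Q Q * f Q := by
  have : ∀ Q, twirlMoment s M Q Q = ∑ P, M P P * twirl s P P Q Q := fun Q => by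
    refine Finset.sum_congr rfl fun P _ => ?_
    rw [Finset.sum_eq_single P]
    · intro P' _ hP'
      rw [twirl_diag_eq_zero s hP'.symm, mul_zero]
    · simp
  simp only [this, Finset.sum_mul, Finset.mul_sum]
  rw [Finset.sum_comm]
  exact Finset.sum_congr rfl fun P _ => Finset.sum_congr rfl fun Q _ => by ring

/-- The second moments `M` have agreeing strings on the qubits in `c`, and their diagonal dominates
the weights `w` placed on the strings `zify c h`. -/
structure MomentBound (F : Finset (PauliString N)) (c : Finset (Fin N)) (w : PauliString N → ℝ)
    (M : PauliString N → PauliString N → ℝ) : Prop where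
  agree : ∀ Q Q', M Q Q' ≠ 0 → ∀ q ∈ c, Q q = Q' q
  nonneg : ∀ h, 0 ≤ w h
  lower : ∀ f : PauliString N → ℝ, (∀ Q, 0 ≤ f Q) →
    ∑ h ∈ F, w h * f (zify c h) ≤ ∑ Q, M Q Q * f Q

/-- The loss of weight of a string in a block. -/
noncomputable def blockFactor (s : Finset (Fin N)) (h : PauliString N) : ℝ :=
  if (h.support ∩ s).Nonempty then ((4 : ℝ) ^ s.card)⁻¹ else 1

theorem blockFactor_nonneg (s : Finset (Fin N)) (h : PauliString N) : 0 ≤ blockFactor s h := by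
  unfold blockFactor; split_ifs <;> positivity

theorem support_inter_nonempty_iff (h : PauliString N) (s : Finset (Fin N)) :
    (h.support ∩ s).Nonempty ↔ ∃ q ∈ s, h q ≠ .I := by
  simp [Finset.Nonempty, support, and_comm]

theorem MomentBound.block_step (hM : MomentBound F c w M) (s : Finset (Fin N)) :
    MomentBound F (c ∪ s) (fun h => w h * blockFactor s h) (twirlMoment s M) where
  agree Q Q' h := twirlMoment_ne_zero h hM.agree
  nonneg h := mul_nonneg (hM.nonneg h) (blockFactor_nonneg s h)
  lower f hf := by
    rw [sum_twirlMoment_diag_mul]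
    refine le_trans (Finset.sum_le_sum fun h _ => ?_) (hM.lower _ fun P => Finset.sum_nonneg fun Q _ =>
      mul_nonneg (twirl_diag_nonneg s P Q) (hf Q))
    rw [mul_assoc]
    refine mul_le_mul_of_nonneg_left ?_ (hM.nonneg h)
    -- Of all transitions, only the one that writes `Z` on the block is kept.
    refine le_trans ?_ (Finset.single_le_sum
      (f := fun Q => twirl s (zify c h) (zify c h) Q Q * f Q) (fun Q _ =>
      mul_nonneg (twirl_diag_nonneg s _ Q) (hf Q)) (Finset.mem_univ (zify (c ∪ s) h)))
    refine mul_le_mul_of_nonneg_right ?_ (hf _)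
    unfold blockFactor
    split_ifs with hs
    · obtain ⟨q, hq, hqq⟩ := (support_inter_nonempty_iff h s).mp hs
      exact inv_le_twirl s (fun q hq => zify_union_apply s h hq)
        ⟨q, hq, (zify_ne_I_iff _ _ _).mpr hqq⟩ ⟨q, hq, (zify_ne_I_iff _ _ _).mpr hqq⟩
    · rw [support_inter_nonempty_iff] at hs
      push Not at hs
      have hz : zify (c ∪ s) h = zify c h := by
        funext q
        by_cases hq : q ∈ s
        · simp [zify, hs q hq]
        · exact zify_union_apply s h hq
      have ht : ∀ q ∈ s, zify c h q = .I := fun q hq => by simp [zify, hs q hq]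
      rw [hz, twirl_of_trivial s ht]

/-- Propagation through a block that contains the commutator with a Pauli string. -/
theorem MomentBound.commutator_step (hM : MomentBound F c w M) {Ω : PauliString N}
    (hΩ : ∀ q ∉ s, Ω q = .I) (hne : ∃ q, Ω q ≠ .I) (hF : ∀ h ∈ F, ∃ q ∈ s, h q ≠ .I)
    {η : PauliString N → ℝ} (hη : ∀ Q, η Q ^ 2 = if sign Q Ω = -1 then 4 else 0)
    {M' : PauliString N → PauliString N → ℝ}
    (hM' : ∀ Q Q', M' Q Q' = η Q * η Q' * twirlMoment s M (mul Q Ω) (mul Q' Ω)) :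
    MomentBound F (c ∪ s) (fun h => w h * (2 * ((4 : ℝ) ^ s.card)⁻¹)) (twirlMoment s M') where
  agree Q Q' h := by
    refine fun q hq => twirlMoment_ne_zero (c := c ∪ s) h (fun P P' hP q hq => ?_) q
      (Finset.mem_union_left _ hq)
    rw [hM'] at hP
    have := twirlMoment_ne_zero (right_ne_zero_of_mul hP) hM.agree q hq
    rw [← Pauli.mul_mul_cancel_right (P q) (Ω q), ← Pauli.mul_mul_cancel_right (P' q) (Ω q)]
    exact congrArg (Pauli.mul · (Ω q)) this
  nonneg h := mul_nonneg (hM.nonneg h) (by positivity)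
  lower f hf := by
    set f₁ : PauliString N → ℝ := fun P => ∑ Q, twirl s P P Q Q * f Q with hf₁
    have hf₁0 : ∀ P, 0 ≤ f₁ P := fun P => Finset.sum_nonneg fun Q _ =>
      mul_nonneg (twirl_diag_nonneg s P Q) (hf Q)
    -- The test function pulled back through the left design and the commutator; the factor is `η ^
    -- 2`.
    set f₂ : PauliString N → ℝ := fun R => (if sign R Ω = -1 then 4 else 0) * f₁ (mul R Ω) with hf₂
    have hf₂0 : ∀ P, 0 ≤ f₂ P := fun P => mul_nonneg (by split_ifs <;> norm_num) (hf₁0 _)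
    have hsign : ∀ P, sign (mul P Ω) Ω = sign P Ω := fun P => by
      rw [sign_mul_left, sign_self, mul_one]
    -- Multiplication by `Ω` is an involution up to phase that preserves the sign against `Ω`, so
    -- the sum may run over the strings before the commutator.
    have hreindex : ∑ P, M' P P * f₁ P = ∑ R, twirlMoment s M R R * f₂ R := by
      refine Fintype.sum_equiv (Function.Involutive.toPerm (fun P => mul P Ω) fun P =>
        mul_mul_cancel_right P Ω) _ _ fun P => ?_
      change M' P P * f₁ P = twirlMoment s M (mul P Ω) (mul P Ω) * f₂ (mul P Ω)
      have he : (if sign (mul P Ω) Ω = -1 then (4 : ℝ) else 0) = η P ^ 2 := by rw [hη, hsign]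
      simp only [hM', hf₂, mul_mul_cancel_right, he]
      ring
    rw [sum_twirlMoment_diag_mul, hreindex, sum_twirlMoment_diag_mul]
    refine le_trans (Finset.sum_le_sum fun h hh => ?_) (hM.lower _ fun P => Finset.sum_nonneg fun Q _ =>
      mul_nonneg (twirl_diag_nonneg s P Q) (hf₂0 Q))
    rw [mul_assoc]
    refine mul_le_mul_of_nonneg_left ?_ (hM.nonneg h)
    obtain ⟨q, hq, hqq⟩ := hF h hh
    -- The strings reachable by the right design that survive the commutator. Each, along with its
    -- product by `Ω`, is non-trivial on `s`, so both designs have their lower bounds.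
    set S := (agreeOutside s (zify c h)).filter fun R => sign R Ω = -1 with hS
    have hterm : ∀ R ∈ S, ((4 : ℝ) ^ s.card)⁻¹ * (4 * (((4 : ℝ) ^ s.card)⁻¹ * f (zify (c ∪ s) h))) ≤
        twirl s (zify c h) (zify c h) R R * f₂ R := by
      intro R hR
      rw [hS, Finset.mem_filter, mem_agreeOutside] at hR
      have h1 : ((4 : ℝ) ^ s.card)⁻¹ ≤ twirl s (zify c h) (zify c h) R R :=
        inv_le_twirl s hR.1 ⟨q, hq, (zify_ne_I_iff _ _ _).mpr hqq⟩
          (exists_ne_I_of_anticommute s hΩ hR.2)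
      refine mul_le_mul h1 ?_ (by have := hf (zify (c ∪ s) h); positivity) (twirl_diag_nonneg s _ _)
      simp only [hf₂, if_pos hR.2]
      refine mul_le_mul_of_nonneg_left ?_ (by norm_num)
      refine le_trans (mul_le_mul_of_nonneg_right ?_ (hf _)) (Finset.single_le_sum
        (f := fun Q => twirl s (mul R Ω) (mul R Ω) Q Q * f Q) (fun Q _ =>
        mul_nonneg (twirl_diag_nonneg s _ Q) (hf Q)) (Finset.mem_univ (zify (c ∪ s) h)))
      refine inv_le_twirl s (fun i hi => ?_) (exists_ne_I_of_anticommute s hΩ ((hsign R).trans hR.2))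
        ⟨q, hq, (zify_ne_I_iff _ _ _).mpr hqq⟩
      rw [zify_union_apply s h hi, mul, hΩ i hi, Pauli.mul_I, hR.1 i hi]
    refine le_trans (le_of_eq ?_) ((Finset.sum_le_sum hterm).trans
      (Finset.sum_le_sum_of_subset_of_nonneg (Finset.subset_univ S) fun R _ _ =>
        mul_nonneg (twirl_diag_nonneg s _ R) (hf₂0 R)))
    -- Counting `S` recovers one factor `4 ^ |s| / 2`, which leaves `2 * 4 ^ (-|s|)`.
    have hcard : (2 : ℝ) * S.card = 4 ^ s.card := by
      exact_mod_cast two_mul_card_anticommute s hΩ hne (zify c h)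
    rw [Finset.sum_const, nsmul_eq_mul, ← hcard]
    have : (S.card : ℝ) ≠ 0 := fun h0 => by
      rw [h0, mul_zero] at hcard; exact (pow_pos (by norm_num : (0 : ℝ) < 4) s.card).ne hcard
    field_simp
    ring

end MomentBound

/-! ### Exponentials of Pauli strings -/

section Exponential

open PauliString

variable {N : ℕ}

open scoped Matrix.Norms.Operator in
theorem embedOp_exp (s : Finset (Fin N)) (A : Matrix (s → Fin 2) (s → Fin 2) ℂ) :
    embedOp s (NormedSpace.exp A) = NormedSpace.exp (embedOp s A) :=
  NormedSpace.map_exp (embedRingHom s) (continuous_embedOp s) A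

open scoped Matrix.Norms.Operator in
theorem hasDerivAt_exp_smul (A : QOp N) (t : ℝ) :
    HasDerivAt (fun t : ℝ => NormedSpace.exp (t • A)) (NormedSpace.exp (t • A) * A) t :=
  hasDerivAt_exp_smul_const A t

open scoped Matrix.Norms.Operator in
theorem continuous_exp_smul (A : QOp N) : Continuous fun t : ℝ => NormedSpace.exp (t • A) :=
  continuous_iff_continuousAt.mpr fun t => (hasDerivAt_exp_smul A t).continuousAt

theorem neg_I_mul_smul (t : ℝ) (A : QOp N) :
    (-(Complex.I * (t : ℂ))) • A = t • (-(Complex.I • A)) := by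
  rw [neg_smul, smul_neg, mul_comm, mul_smul]
  rfl

theorem exp_conjTranspose_mul_exp {A : QOp N} (hA : A.IsHermitian) (t : ℝ) :
    (NormedSpace.exp ((-(Complex.I * (t : ℂ))) • A)).conjTranspose = NormedSpace.exp (t • (Complex.I • A)) ∧
    NormedSpace.exp (t • (Complex.I • A)) * NormedSpace.exp ((-(Complex.I * (t : ℂ))) • A) = 1 := by
  have h1 : ((-(Complex.I * (t : ℂ))) • A).conjTranspose = t • (Complex.I • A) := by
    rw [Matrix.conjTranspose_smul, hA.eq, star_neg, star_mul', Complex.star_def, Complex.conj_I,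
      Complex.conj_ofReal, neg_mul, neg_neg, mul_comm, mul_smul]
    rfl
  refine ⟨by rw [← Matrix.exp_conjTranspose, h1], ?_⟩
  have hc : Commute (t • (Complex.I • A)) (-(t • (Complex.I • A))) := (Commute.refl _).neg_right
  rw [neg_I_mul_smul, smul_neg, ← Matrix.exp_add_of_commute _ _ hc, add_neg_cancel,
    NormedSpace.exp_zero]

open scoped Matrix.Norms.Operator in
/-- The derivative of Heisenberg evolution under a rotation generated by a Pauli string. -/
theorem hasDerivAt_heis_exp (P : PauliString N) (X Y A : QOp N) (t : ℝ) :
    HasDerivAt (fun t : ℝ =>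
        (heis (X * NormedSpace.exp ((-(Complex.I * (t : ℂ))) • P.toOp) * Y) A 0 0).re)
      (heis Y (heis (NormedSpace.exp ((-(Complex.I * (t : ℂ))) • P.toOp))
        (pauliCommutator P (heis X A))) 0 0).re t := by
  set E : ℝ → QOp N := fun t => NormedSpace.exp (t • (-(Complex.I • P.toOp)))
  set E' : ℝ → QOp N := fun t => NormedSpace.exp (t • (Complex.I • P.toOp))
  have hE : ∀ t : ℝ, NormedSpace.exp ((-(Complex.I * (t : ℂ))) • P.toOp) = E t := fun t => by
    rw [neg_I_mul_smul]
  have hE' : ∀ t, (E t).conjTranspose = E' t := fun t => by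
    rw [← hE, (exp_conjTranspose_mul_exp P.toOp_isHermitian t).1]
  have hc : P.toOp * E t = E t * P.toOp := by
    have h : Commute P.toOp (t • (-(Complex.I • P.toOp))) :=
      (((Commute.refl P.toOp).smul_right Complex.I).neg_right).smul_right t
    exact h.exp_right
  -- Everything outside the rotation is a fixed real-linear functional, so only the conjugated
  -- operator has to be differentiated.
  let L : QOp N →ₗ[ℝ] ℝ :=
    { toFun := fun B => (heis Y B 0 0).re
      map_add' := fun B C => by simp [heis, mul_add, add_mul]
      map_smul' := fun r B => by simp [heis] }
  have hd := (((hasDerivAt_exp_smul (Complex.I • P.toOp) t).mul_const (heis X A)).mul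
    (hasDerivAt_exp_smul (-(Complex.I • P.toOp)) t))
  have hL := (LinearMap.toContinuousLinearMap L).hasFDerivAt.comp_hasDerivAt t hd
  simp only [hE]
  have hval : (heis Y (heis (E t) (pauliCommutator P (heis X A))) 0 0).re =
      L (E' t * (Complex.I • P.toOp) * heis X A * E t +
        E' t * heis X A * (E t * (-(Complex.I • P.toOp)))) := by
    change _ = (heis Y _ 0 0).re
    congr 3
    rw [heis, hE', pauliCommutator]
    simp only [Matrix.mul_smul, Matrix.smul_mul, mul_neg, mul_sub, sub_mul, smul_sub, mul_assoc, hc]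
    rw [← sub_eq_add_neg]
  have hfun : (fun t : ℝ => (heis (X * E t * Y) A 0 0).re) =
      L ∘ fun t => E' t * heis X A * E t := by
    funext t
    change _ = (heis Y (E' t * heis X A * E t) 0 0).re
    rw [heis_mul, heis_mul, heis.eq_def (E t), hE']
  rw [hval, hfun]
  exact hL

end Exponential

/-! ### The cost derivative in the Heisenberg picture -/

namespace VQE

open PauliString

variable (V : VQE)

instance instIsProbabilityMeasureLaw : IsProbabilityMeasure V.law := V.law_isProbability

/-- In a decreasing list the larger indices come first, so filtering by the union splits; this
factors ordered gate products. -/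
theorem filter_mem_union_of_lt {n : ℕ} {S T : Finset (Fin n)} (h : ∀ a ∈ S, ∀ b ∈ T, a < b) :
    ∀ l : List (Fin n), l.Pairwise (· > ·) →
      l.filter (· ∈ S ∪ T) = l.filter (· ∈ T) ++ l.filter (· ∈ S)
  | [], _ => rfl
  | a :: l, hl => by
    rw [List.pairwise_cons] at hl
    have ih := filter_mem_union_of_lt h l hl.2
    by_cases haT : a ∈ T
    · have haS : a ∉ S := fun haS => lt_irrefl _ (h a haS a haT)
      simp only [List.filter_cons, Finset.mem_union, haT, haS, or_true, decide_true, decide_false,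
        if_true, Bool.false_eq_true, if_false, List.cons_append]
      rw [← ih]
      simp only [Finset.mem_union]
    · by_cases haS : a ∈ S
      · have hT : l.filter (· ∈ T) = [] := by
          rw [List.filter_eq_nil_iff]
          intro b hb hbT
          exact lt_asymm (h a haS b (by simpa using hbT)) (hl.1 b hb)
        rw [hT, List.nil_append] at ih
        simp only [List.filter_cons, Finset.mem_union, haT, haS, true_or, decide_true, decide_false,
          if_true, Bool.false_eq_true, if_false, hT, List.nil_append]
        rw [← ih]
        simp only [Finset.mem_union]
      · simp only [List.filter_cons, Finset.mem_union, haT, haS, or_self, decide_false,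
          Bool.false_eq_true, if_false]
        rw [← ih]
        simp only [Finset.mem_union]

theorem pairwise_reverse_finRange (n : ℕ) : (List.finRange n).reverse.Pairwise (· > ·) :=
  List.pairwise_reverse.mpr (List.pairwise_lt_finRange n)

theorem gateProd_union {S T : Finset (Fin V.numGates)} (h : ∀ a ∈ S, ∀ b ∈ T, a < b)
    (θ : Fin V.numGates → ℝ) :
    V.gateProd (S ∪ T) θ = V.gateProd T θ * V.gateProd S θ := by
  rw [gateProd, filter_mem_union_of_lt h _ (pairwise_reverse_finRange _), List.map_append,
    List.prod_append, gateProd, gateProd]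

theorem gateProd_congr {S : Finset (Fin V.numGates)} {θ θ' : Fin V.numGates → ℝ}
    (h : ∀ ν ∈ S, θ ν = θ' ν) : V.gateProd S θ = V.gateProd S θ' := by
  unfold gateProd
  congr 1
  refine List.map_congr_left fun ν hν => ?_
  rw [h ν (by simpa using (List.mem_filter.mp hν).2)]

theorem gateProd_empty (θ : Fin V.numGates → ℝ) : V.gateProd ∅ θ = 1 := by
  simp [gateProd]

theorem gateProd_singleton (ν : Fin V.numGates) (θ : Fin V.numGates → ℝ) :
    V.gateProd {ν} θ = V.gate ν (θ ν) := by
  have h : (List.finRange V.numGates).reverse.filter (· ∈ ({ν} : Finset _)) = [ν] := by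
    have h1 := List.filter_eq (l := (List.finRange V.numGates).reverse) ν
    rw [List.count_eq_one_of_mem (List.nodup_reverse.mpr (List.nodup_finRange _)) (by simp)] at h1
    rw [List.replicate_one] at h1
    rw [← h1]
    refine List.filter_congr fun x _ => ?_
    simp [eq_comm]
  rw [gateProd, h]
  simp

/-- The unitary of a block. -/
noncomputable def blockOp (k : Fin V.numBlocks) (θ : Fin V.numGates → ℝ) : QOp V.numQubits :=
  V.gateProd (Finset.univ.filter fun ν => V.block ν = k) θ

theorem gateProd_blocks (θ : Fin V.numGates → ℝ) : ∀ l : List (Fin V.numBlocks),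
    l.Pairwise (· > ·) → V.gateProd (Finset.univ.filter fun ν => V.block ν ∈ l) θ =
      (l.map fun k => V.blockOp k θ).prod
  | [], _ => by simp [gateProd_empty]
  | k :: l, hl => by
    rw [List.pairwise_cons] at hl
    have h : (Finset.univ.filter fun ν => V.block ν ∈ k :: l) =
        (Finset.univ.filter fun ν => V.block ν ∈ l) ∪
          (Finset.univ.filter fun ν => V.block ν = k) := by
      ext ν; simp [or_comm]
    rw [h, gateProd_union, gateProd_blocks θ l hl.2, List.map_cons, List.prod_cons]
    · rfl
    · intro a ha b hb
      simp only [Finset.mem_filter, Finset.mem_univ, true_and] at ha hb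
      exact V.block_mono.reflect_lt (by rw [hb]; exact hl.1 _ ha)

/-- The blocks after the differential block, latest first. -/
def laterBlocks : List (Fin V.numBlocks) :=
  (List.finRange V.numBlocks).reverse.filter (V.diffBlock < ·)

/-- The blocks before the differential block, latest first. -/
def earlierBlocks : List (Fin V.numBlocks) :=
  (List.finRange V.numBlocks).reverse.filter (· < V.diffBlock)

theorem pairwise_laterBlocks : V.laterBlocks.Pairwise (· > ·) :=
  (pairwise_reverse_finRange _).filter _

theorem pairwise_earlierBlocks : V.earlierBlocks.Pairwise (· > ·) :=
  (pairwise_reverse_finRange _).filter _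

theorem mem_laterBlocks {k : Fin V.numBlocks} : k ∈ V.laterBlocks ↔ V.diffBlock < k := by
  simp [laterBlocks]

theorem mem_earlierBlocks {k : Fin V.numBlocks} : k ∈ V.earlierBlocks ↔ k < V.diffBlock := by
  simp [earlierBlocks]

theorem segmentUnitary_diff (θ : Fin V.numGates → ℝ) :
    V.segmentUnitary .diff θ = V.gate V.diffGate (θ V.diffGate) := V.gateProd_singleton _ _

theorem circuit_eq (θ : Fin V.numGates → ℝ) : V.circuit θ =
    (V.laterBlocks.map fun k => V.blockOp k θ).prod * (V.segmentUnitary .right θ *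
      (V.segmentUnitary .diff θ * (V.segmentUnitary .left θ *
        (V.earlierBlocks.map fun k => V.blockOp k θ).prod))) := by
  have huniv : (Finset.univ : Finset (Fin V.numGates)) =
      ((((Finset.univ.filter fun ν => V.block ν ∈ V.earlierBlocks) ∪ V.segmentGates .left) ∪
        V.segmentGates .diff) ∪ V.segmentGates .right) ∪
        (Finset.univ.filter fun ν => V.block ν ∈ V.laterBlocks) := by
    ext ν
    simp only [Finset.mem_univ, segmentGates, Finset.mem_union, Finset.mem_filter, true_and,
      Finset.mem_singleton, mem_earlierBlocks, mem_laterBlocks, true_iff]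
    rcases lt_trichotomy (V.block ν) V.diffBlock with h | h | h
    · exact .inl (.inl (.inl (.inl h)))
    · rcases lt_trichotomy ν V.diffGate with h' | h' | h'
      · exact .inl (.inl (.inl (.inr ⟨h, h'⟩)))
      · exact .inl (.inl (.inr h'))
      · exact .inl (.inr ⟨h, h'⟩)
    · exact .inr h
  have hlt : ∀ {a b}, V.block a < V.block b → a < b := fun h => V.block_mono.reflect_lt h
  rw [circuit, huniv, gateProd_union, gateProd_union, gateProd_union, gateProd_union,
    gateProd_blocks _ _ _ V.pairwise_earlierBlocks, gateProd_blocks _ _ _ V.pairwise_laterBlocks]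
  · rfl
  all_goals
    intro a ha b hb
    simp only [segmentGates, Finset.mem_union, Finset.mem_filter, Finset.mem_univ, true_and,
      Finset.mem_singleton, mem_earlierBlocks, mem_laterBlocks] at ha hb
  · exact hlt (by rw [hb.1]; exact ha)
  · subst hb
    exact ha.elim (fun h => hlt h) fun h => h.2
  · rcases ha with (h | h) | h
    · exact hlt (by rw [hb.1]; exact h)
    · exact h.2.trans hb.2
    · rw [h]; exact hb.2
  · refine hlt (lt_of_le_of_lt ?_ hb)
    rcases ha with ((h | h) | h) | h
    · exact h.le
    · exact h.1.le
    · rw [h]; rfl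
    · exact h.1.le

/-- The evolution of an observable through a list of blocks. -/
noncomputable def evolve (l : List (Fin V.numBlocks)) (A : (Fin V.numGates → ℝ) → QOp V.numQubits)
    (θ : Fin V.numGates → ℝ) : QOp V.numQubits :=
  heis (l.map fun k => V.blockOp k θ).prod (A θ)

theorem evolve_nil (A : (Fin V.numGates → ℝ) → QOp V.numQubits) : V.evolve [] A = A := by
  funext θ; simp [evolve, heis]

theorem evolve_cons (k : Fin V.numBlocks) (l : List (Fin V.numBlocks))
    (A : (Fin V.numGates → ℝ) → QOp V.numQubits) :
    V.evolve (k :: l) A = V.evolve l fun θ => heis (V.blockOp k θ) (A θ) := by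
  funext θ; simp [evolve, heis_mul]

/-- The operator whose expectation in the initial state is the cost derivative. -/
noncomputable def derivOp (g : PauliString V.numQubits) :
    (Fin V.numGates → ℝ) → QOp V.numQubits :=
  V.evolve V.earlierBlocks fun θ => heis (V.segmentUnitary .left θ)
    (heis (V.segmentUnitary .diff θ) (pauliCommutator g (heis (V.segmentUnitary .right θ)
      (V.evolve V.laterBlocks (fun _ => V.hamiltonian) θ))))

theorem cost_eq (θ : Fin V.numGates → ℝ) :
    V.cost θ = (heis (V.circuit θ) V.hamiltonian 0 0).re := by
  rw [cost, initialState, mul_assoc, mul_assoc, ← mul_assoc (V.circuit θ).conjTranspose, ← heis,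
    Matrix.trace_single_mul, one_smul]

theorem costDeriv_eq {g : PauliString V.numQubits} (hg : V.gen V.diffGate = g.toOp)
    (θ : Fin V.numGates → ℝ) : V.costDeriv θ = (V.derivOp g θ 0 0).re := by
  set X := (V.laterBlocks.map fun k => V.blockOp k θ).prod * V.segmentUnitary .right θ with hX
  set Y := V.segmentUnitary .left θ * (V.earlierBlocks.map fun k => V.blockOp k θ).prod with hY
  have hne : ∀ (t : ℝ) ν, ν ≠ V.diffGate → Function.update θ V.diffGate t ν = θ ν :=
    fun t ν h => Function.update_of_ne h _ _
  -- The differential parameter enters no segment except the differential gate.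
  have hblock : ∀ (t : ℝ) k, k ≠ V.diffBlock →
      V.blockOp k (Function.update θ V.diffGate t) = V.blockOp k θ := fun t k hk =>
    V.gateProd_congr fun ν hν => hne t ν fun h => hk (by
      rw [← (Finset.mem_filter.mp hν).2, h]; rfl)
  have hcirc : ∀ t, V.circuit (Function.update θ V.diffGate t) =
      X * NormedSpace.exp ((-(Complex.I * (t : ℂ))) • g.toOp) * Y := fun t => by
    rw [circuit_eq, List.map_congr_left fun k hk => hblock t k (V.mem_laterBlocks.mp hk).ne',
      List.map_congr_left fun k hk => hblock t k (V.mem_earlierBlocks.mp hk).ne, segmentUnitary_diff,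
      Function.update_self, gate, hg]
    have hr : V.segmentUnitary .right (Function.update θ V.diffGate t) =
        V.segmentUnitary .right θ := V.gateProd_congr fun ν hν => hne t ν
          ((Finset.mem_filter.mp hν).2.2.ne')
    have hl : V.segmentUnitary .left (Function.update θ V.diffGate t) =
        V.segmentUnitary .left θ := V.gateProd_congr fun ν hν => hne t ν
          ((Finset.mem_filter.mp hν).2.2.ne)
    rw [hr, hl, hX, hY]
    simp only [mul_assoc]
  have hd := (hasDerivAt_heis_exp g X Y V.hamiltonian (θ V.diffGate)).deriv
  simp only [← hcirc, ← cost_eq] at hd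
  rw [costDeriv, hd]
  have hdiff : NormedSpace.exp ((-(Complex.I * (θ V.diffGate : ℂ))) • g.toOp) =
      V.segmentUnitary .diff θ := by rw [segmentUnitary_diff, gate, hg]
  rw [hdiff, hX, hY, heis_mul, heis_mul]
  rfl

end VQE

/-! ### Variance of the cost derivative -/

namespace VQE

open PauliString

variable (V : VQE)

/-- The information generated by the segments in `S`. -/
@[reducible] noncomputable def segmentInfo (S : Set (Segment V.numBlocks V.diffBlock)) :
    MeasurableSpace (Fin V.numGates → ℝ) :=
  ⨆ σ ∈ S, MeasurableSpace.comap (V.segmentUnitary σ) inferInstance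

theorem segmentInfo_mono {S T : Set (Segment V.numBlocks V.diffBlock)} (h : S ⊆ T) :
    V.segmentInfo S ≤ V.segmentInfo T := biSup_mono h

theorem measurable_segmentInfo {S : Set (Segment V.numBlocks V.diffBlock)}
    {σ : Segment V.numBlocks V.diffBlock} (h : σ ∈ S) :
    Measurable[V.segmentInfo S] (V.segmentUnitary σ) :=
  measurable_iff_comap_le.mpr
    (le_biSup (fun σ => MeasurableSpace.comap (V.segmentUnitary σ) inferInstance) h)

theorem support_subset_blockSupport {g : PauliString V.numQubits}
    (hg : V.gen V.diffGate = g.toOp) : ∀ q ∉ V.blockSupport V.diffBlock, g q = .I := by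
  intro q hq
  by_contra h
  apply hq
  refine Finset.mem_biUnion.mpr ⟨V.diffGate, Finset.mem_filter.mpr ⟨Finset.mem_univ _, rfl⟩, ?_⟩
  rw [hg]
  exact support_subset_opSupport g (by simpa [support] using h)

theorem continuous_gate (ν : Fin V.numGates) : Continuous (V.gate ν) := by
  have : V.gate ν = fun t : ℝ => NormedSpace.exp (t • (-(Complex.I • V.gen ν))) := by
    funext t; rw [gate, neg_I_mul_smul]
  rw [this]
  exact continuous_exp_smul _

theorem measurable_segmentUnitary_diff : Measurable (V.segmentUnitary .diff) := by
  have : V.segmentUnitary .diff = fun θ => V.gate V.diffGate (θ V.diffGate) :=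
    funext V.segmentUnitary_diff
  rw [this]
  exact ((V.continuous_gate _).comp (continuous_apply _)).measurable

/-- The generator lives on the block support, hence so does its exponential. This makes the gate
absorbable by the left design. -/
theorem exists_segmentUnitary_diff_eq {g : PauliString V.numQubits}
    (hg : V.gen V.diffGate = g.toOp) :
    ∃ u : (Fin V.numGates → ℝ) →
      Matrix.unitaryGroup (V.blockSupport V.diffBlock → Fin 2) ℂ,
      ∀ θ, V.segmentUnitary .diff θ = embedOp (V.blockSupport V.diffBlock) (u θ) := by
  have h : ∀ θ : Fin V.numGates → ℝ, embedOp (V.blockSupport V.diffBlock)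
      (NormedSpace.exp ((-(Complex.I * (θ V.diffGate : ℂ))) •
        g.localOp (V.blockSupport V.diffBlock))) = V.segmentUnitary .diff θ := fun θ => by
    rw [embedOp_exp, embedOp_smul, embedOp_localOp _ (V.support_subset_blockSupport hg),
      segmentUnitary_diff, gate, hg]
  refine ⟨fun θ => ⟨_, mem_unitaryGroup_of_embedOp _ (?_ :
    (embedOp _ (NormedSpace.exp ((-(Complex.I * (θ V.diffGate : ℂ))) •
        g.localOp (V.blockSupport V.diffBlock)))).conjTranspose * embedOp _ _ = 1)⟩,
    fun θ => (h θ).symm⟩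
  have h2 := exp_conjTranspose_mul_exp g.toOp_isHermitian (θ V.diffGate)
  rw [h, segmentUnitary_diff, gate, hg, h2.1, h2.2]

variable {V}

theorem Assumptions.measurable_segmentUnitary (hV : V.Assumptions)
    (σ : Segment V.numBlocks V.diffBlock) : Measurable (V.segmentUnitary σ) := by
  cases σ with
  | block k hk => exact (hV.block_design k hk).measurable
  | left => exact hV.left_design.measurable
  | diff => exact V.measurable_segmentUnitary_diff
  | right => exact hV.right_design.measurable

theorem Assumptions.segmentInfo_le (hV : V.Assumptions)
    (S : Set (Segment V.numBlocks V.diffBlock)) : V.segmentInfo S ≤ MeasurableSpace.pi :=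
  iSup₂_le fun σ _ => (hV.measurable_segmentUnitary σ).comap_le

theorem Assumptions.indepFun (hV : V.Assumptions) {S : Set (Segment V.numBlocks V.diffBlock)}
    {σ : Segment V.numBlocks V.diffBlock} (hσ : σ ∉ S)
    {A : (Fin V.numGates → ℝ) → QOp V.numQubits} (hA : Measurable[V.segmentInfo S] A) :
    IndepFun A (V.segmentUnitary σ) V.law := by
  have h := indep_iSup_of_disjoint (fun σ => (hV.measurable_segmentUnitary σ).comap_le)
    hV.indep (Set.disjoint_singleton_right.mpr hσ)
  rw [IndepFun_iff_Indep]
  refine indep_of_indep_of_le_left (indep_of_indep_of_le_right h ?_) hA.comap_le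
  exact le_biSup (fun σ => MeasurableSpace.comap (V.segmentUnitary σ) inferInstance)
    (Set.mem_singleton σ)

/-- A random observable depending on the segments in `S`, with a lower bound on its second
moments. -/
structure ChainState (V : VQE) (S : Set (Segment V.numBlocks V.diffBlock))
    (c : Finset (Fin V.numQubits)) (w : PauliString V.numQubits → ℝ)
    (A : (Fin V.numGates → ℝ) → QOp V.numQubits) : Prop where
  obs : IsRandomObservable (V.segmentInfo S) A
  bound : MomentBound V.relevantTerms c w (secondMoment V.law A)

variable {S : Set (Segment V.numBlocks V.diffBlock)} {c : Finset (Fin V.numQubits)}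
  {w : PauliString V.numQubits → ℝ} {A : (Fin V.numGates → ℝ) → QOp V.numQubits}

theorem segmentHeis_obs (hA : IsRandomObservable (V.segmentInfo S) A)
    (σ : Segment V.numBlocks V.diffBlock) (hU : IsRandomUnitary (V.segmentUnitary σ)) :
    IsRandomObservable (V.segmentInfo (insert σ S))
      fun θ => heis (V.segmentUnitary σ θ) (A θ) :=
  (hA.mono (V.segmentInfo_mono (Set.subset_insert σ S))).heis_of_measurable
    (V.measurable_segmentInfo (Set.mem_insert σ S)) hU

/-- By independence, the mean coefficients after evolution are linear combinations of those before.
-/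
theorem Assumptions.heis_mean (hV : V.Assumptions) (hA : IsRandomObservable (V.segmentInfo S) A)
    {σ : Segment V.numBlocks V.diffBlock} (hσ : σ ∉ S) (hU : IsRandomUnitary (V.segmentUnitary σ))
    (h : ∀ Q, ∫ θ, PauliString.coeff Q (A θ) ∂V.law = 0) (Q : PauliString V.numQubits) :
    ∫ θ, PauliString.coeff Q (heis (V.segmentUnitary σ θ) (A θ)) ∂V.law = 0 := by
  rw [integral_coeff_heis (hA.mono (hV.segmentInfo_le S)) (hV.measurable_segmentUnitary σ) hU
    (hV.indepFun hσ hA.meas)]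
  simp [h]

/-- The segments that are blocks in the list `l`. -/
def blockSegments (V : VQE) (l : List (Fin V.numBlocks)) : Set (Segment V.numBlocks V.diffBlock) :=
  {σ | ∃ k ∈ l, ∃ hk, σ = .block k hk}

theorem ChainState.evolve (hV : V.Assumptions) : ∀ (l : List (Fin V.numBlocks))
    {S : Set (Segment V.numBlocks V.diffBlock)} {c : Finset (Fin V.numQubits)}
    {w : PauliString V.numQubits → ℝ} {A : (Fin V.numGates → ℝ) → QOp V.numQubits},
    V.ChainState S c w A → l.Nodup → (∀ k ∈ l, k ≠ V.diffBlock) →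
    (∀ k ∈ l, ∀ hk, .block k hk ∉ S) →
    V.ChainState (S ∪ V.blockSegments l) (c ∪ l.toFinset.biUnion V.blockSupport)
      (fun h => w h * (l.map fun k => blockFactor (V.blockSupport k) h).prod) (V.evolve l A) ∧
    ((∀ Q, ∫ θ, PauliString.coeff Q (A θ) ∂V.law = 0) → ∀ Q, ∫ θ, PauliString.coeff Q (V.evolve l A θ) ∂V.law = 0)
  | [], S, c, w, A, hA, _, _, _ => by
    have : S ∪ V.blockSegments [] = S := by simp [blockSegments]
    simpa [evolve_nil, this] using hA
  | k :: l, S, c, w, A, hA, hl, hne, hS => by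
    have hk := hne k List.mem_cons_self
    have hd := hV.block_design k hk
    have hkS := hS k List.mem_cons_self hk
    have h1 : V.ChainState (insert (.block k hk) S) (c ∪ V.blockSupport k)
        (fun h => w h * blockFactor (V.blockSupport k) h)
        (fun θ => heis (V.segmentUnitary (.block k hk) θ) (A θ)) := by
      refine ⟨segmentHeis_obs hA.obs _ hd.isRandomUnitary, ?_⟩
      rw [secondMoment_heis (hA.obs.mono (hV.segmentInfo_le S)) hd (hV.indepFun hkS hA.obs.meas)]
      exact hA.bound.block_step _
    rw [List.nodup_cons] at hl
    have h2 := ChainState.evolve hV l h1 hl.2 (fun k' hk' => hne k' (List.mem_cons_of_mem _ hk'))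
      (fun k' hk' hk'' hmem => by
        rcases Set.mem_insert_iff.mp hmem with h | h
        · injection h with h
          exact hl.1 (h ▸ hk')
        · exact hS k' (List.mem_cons_of_mem _ hk') hk'' h)
    rw [evolve_cons]
    constructor
    · convert h2.1 using 1
      · ext σ
        simp only [blockSegments, Set.mem_union, Set.mem_ofPred_eq, List.mem_cons, Set.mem_insert_iff]
        constructor
        · rintro (h | ⟨k', rfl | hk', hh, rfl⟩)
          · exact .inl (.inr h)
          · exact .inl (.inl rfl)
          · exact .inr ⟨k', hk', hh, rfl⟩
        · rintro ((rfl | h) | ⟨k', hk', hh, rfl⟩)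
          · exact .inr ⟨k, .inl rfl, hk, rfl⟩
          · exact .inl h
          · exact .inr ⟨k', .inr hk', hh, rfl⟩
      · rw [List.toFinset_cons, Finset.biUnion_insert, Finset.union_assoc]
      · funext h
        rw [List.map_cons, List.prod_cons, mul_assoc]
      · rfl
    · intro hmean
      exact h2.2 (hV.heis_mean hA.obs hkS hd.isRandomUnitary hmean)

/-- The weight of a Pauli term of the Hamiltonian in the lower bound. -/
noncomputable def termWeight (V : VQE) (h : PauliString V.numQubits) : ℝ :=
  V.coeff h ^ 2 * (V.laterBlocks.map fun k => blockFactor (V.blockSupport k) h).prod *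
    (2 * ((4 : ℝ) ^ (V.blockSupport V.diffBlock).card)⁻¹) *
    (V.earlierBlocks.map fun k => blockFactor (V.blockSupport k) h).prod

theorem coeff_hamiltonian (Q : PauliString V.numQubits) :
    PauliString.coeff Q V.hamiltonian = V.coeff Q := by
  rw [hamiltonian, coeff_sum]
  simp only [coeff_real_smul, coeff_toOp]
  simp

theorem hamiltonian_isHermitian (V : VQE) : V.hamiltonian.IsHermitian := by
  unfold hamiltonian Matrix.IsHermitian
  rw [Matrix.conjTranspose_sum]
  refine Finset.sum_congr rfl fun h _ => ?_
  rw [Matrix.conjTranspose_smul, h.toOp_isHermitian.eq]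
  simp

/-- Start of the propagation: the covering assumption makes all terms trivial outside the blocks, so
strings agree there and `zify` changes nothing. Terms that miss the differential block are dropped
as non-negative. -/
theorem Assumptions.chainState_hamiltonian (hV : V.Assumptions) :
    V.ChainState ∅ (Finset.univ.biUnion V.blockSupport)ᶜ (fun h => V.coeff h ^ 2)
      (fun _ => V.hamiltonian) where
  obs := .const _ V.hamiltonian_isHermitian
  bound := by
    have hm : ∀ Q Q', secondMoment V.law (fun _ => V.hamiltonian) Q Q' = V.coeff Q * V.coeff Q' :=
      fun Q Q' => by simp [secondMoment, coeff_hamiltonian]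
    have hI : ∀ h, V.coeff h ≠ 0 → ∀ q ∈ (Finset.univ.biUnion V.blockSupport)ᶜ, h q = .I := by
      intro h hh q hq
      by_contra hne
      obtain ⟨k, hk⟩ := hV.covers h (by simpa [terms] using hh) q (by simpa [support] using hne)
      simp only [Finset.mem_compl, Finset.mem_biUnion, Finset.mem_univ, true_and, not_exists] at hq
      exact hq k hk
    refine ⟨fun Q Q' h q hq => ?_, fun h => sq_nonneg _, fun f hf => ?_⟩
    · rw [hm] at h
      rw [hI Q (left_ne_zero_of_mul h) q hq, hI Q' (right_ne_zero_of_mul h) q hq]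
    · refine le_trans (le_of_eq (Finset.sum_congr rfl fun h hh => ?_))
        (Finset.sum_le_sum_of_subset_of_nonneg (Finset.subset_univ V.relevantTerms)
          fun Q _ _ => ?_)
      · have hc : V.coeff h ≠ 0 := by
          have := (Finset.mem_filter.mp hh).1
          simpa [terms] using this
        have hz : zify (Finset.univ.biUnion V.blockSupport)ᶜ h = h := by
          funext q
          by_cases hq : q ∈ (Finset.univ.biUnion V.blockSupport)ᶜ
          · simp [zify, hI h hc q hq]
          · simp only [zify, hq, false_and, if_false]
        rw [hz, hm, pow_two]
      · rw [hm]
        exact mul_nonneg (mul_self_nonneg _) (hf Q)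

theorem Assumptions.chainState_derivOp (hV : V.Assumptions) {g : PauliString V.numQubits}
    (hgs : g.support.Nonempty) (hg : V.gen V.diffGate = g.toOp) :
    V.ChainState Set.univ Finset.univ V.termWeight (V.derivOp g) ∧
      ∀ Q, ∫ θ, PauliString.coeff Q (V.derivOp g θ) ∂V.law = 0 := by
  have hnd : (List.finRange V.numBlocks).reverse.Nodup :=
    List.nodup_reverse.mpr (List.nodup_finRange _)
  obtain ⟨h1, -⟩ := ChainState.evolve hV V.laterBlocks hV.chainState_hamiltonian (hnd.filter _)
    (fun k hk => (V.mem_laterBlocks.mp hk).ne') (fun _ _ _ h => h)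
  rw [Set.empty_union] at h1
  set s := V.blockSupport V.diffBlock with hs
  set S₁ := V.blockSegments V.laterBlocks with hS₁
  set A₁ := V.evolve V.laterBlocks fun _ => V.hamiltonian with hA₁
  have hΩ := V.support_subset_blockSupport hg
  have hgne : ∃ q, g q ≠ .I := by
    obtain ⟨q, hq⟩ := hgs
    exact ⟨q, by simpa [support] using hq⟩
  -- right part of the differential block
  have hR : Segment.right ∉ S₁ := by simp [hS₁, blockSegments]
  have hiR := hV.indepFun hR h1.obs.meas
  have obs₂ := segmentHeis_obs h1.obs .right hV.right_design.isRandomUnitary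
  set S₂ := insert Segment.right S₁
  set A₂ := fun θ => heis (V.segmentUnitary .right θ) (A₁ θ) with hA₂
  have mom₂ : secondMoment V.law A₂ = twirlMoment s (secondMoment V.law A₁) :=
    secondMoment_heis (h1.obs.mono (hV.segmentInfo_le _)) hV.right_design hiR
  have mean₂ : ∀ Q, (∃ q ∈ s, Q q ≠ .I) → ∫ θ, PauliString.coeff Q (A₂ θ) ∂V.law = 0 :=
    fun Q hQ => by
      rw [hA₂, integral_coeff_heis (h1.obs.mono (hV.segmentInfo_le _)) hV.right_design.measurable
        hV.right_design.isRandomUnitary hiR]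
      exact Finset.sum_eq_zero fun P _ => by
        rw [integral_coeff_heis_toOp_eq_zero hV.right_design hQ, mul_zero]
  -- the commutator
  have obs₃ := obs₂.commutator g
  obtain ⟨η, hη, hηmean, hηmom⟩ :=
    secondMoment_commutator (μ := V.law) (obs₂.mono (hV.segmentInfo_le _)) g
  set A₃ := fun θ => pauliCommutator g (A₂ θ) with hA₃
  have mean₃ : ∀ Q, ∫ θ, PauliString.coeff Q (A₃ θ) ∂V.law = 0 := fun Q => by
    rw [hA₃, hηmean]
    rcases eq_or_ne (sign Q g) (-1) with h | h
    -- If `Q` anticommutes with `g`, so does their product; it is then non-trivial on the block and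
    -- has mean zero after the right design.
    · rw [mean₂ _ (exists_ne_I_of_anticommute s hΩ (by rw [sign_mul_left, h, sign_self]; rfl)),
        mul_zero]
    · have := hη Q
      rw [if_neg h] at this
      rw [pow_eq_zero_iff two_ne_zero |>.mp this, zero_mul]
  -- the differential gate
  obtain ⟨u, hu⟩ := V.exists_segmentUnitary_diff_eq hg
  have hUd : IsRandomUnitary (V.segmentUnitary .diff) := fun θ => by rw [hu, embedOp_unitary]
  have hD : Segment.diff ∉ S₂ := by simp [S₂, hS₁, blockSegments]
  have obs₄ := segmentHeis_obs obs₃ .diff hUd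
  have mean₄ := hV.heis_mean obs₃ hD hUd mean₃
  set S₄ := insert Segment.diff S₂
  set A₄ := fun θ => heis (V.segmentUnitary .diff θ) (A₃ θ) with hA₄
  -- No design property of the differential gate is needed: the invariance of the left design
  -- absorbs it.
  have mom₄ : twirlMoment s (secondMoment V.law A₄) = twirlMoment s (secondMoment V.law A₃) :=
    twirlMoment_secondMoment_heis (obs₃.mono (hV.segmentInfo_le _)) hu
      V.measurable_segmentUnitary_diff
  -- left part of the differential block
  have hL : Segment.left ∉ S₄ := by simp [S₄, S₂, hS₁, blockSegments]
  have obs₅ := segmentHeis_obs obs₄ .left hV.left_design.isRandomUnitary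
  have mean₅ := hV.heis_mean obs₄ hL hV.left_design.isRandomUnitary mean₄
  have mom₅ := secondMoment_heis (obs₄.mono (hV.segmentInfo_le _)) hV.left_design
    (hV.indepFun hL obs₄.meas)
  rw [mom₄] at mom₅
  set S₅ := insert Segment.left S₄
  set A₅ := fun θ => heis (V.segmentUnitary .left θ) (A₄ θ) with hA₅
  have bound₅ := h1.bound.commutator_step hΩ hgne (fun h hh =>
    (support_inter_nonempty_iff h s).mp (Finset.mem_filter.mp hh).2) hη
    (M' := secondMoment V.law A₃) fun Q Q' => by rw [← mom₂]; exact hηmom Q Q'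
  rw [← mom₅] at bound₅
  obtain ⟨h6, mean₆⟩ := ChainState.evolve hV V.earlierBlocks ⟨obs₅, bound₅⟩ (hnd.filter _)
    (fun k hk => (V.mem_earlierBlocks.mp hk).ne) (fun k hk hk' h => by
      simp only [S₅, S₄, S₂, hS₁, blockSegments, Set.mem_insert_iff, Set.mem_ofPred_eq, reduceCtorEq,
        false_or, Segment.block.injEq] at h
      obtain ⟨k', hk'', -, rfl⟩ := h
      exact lt_asymm (V.mem_earlierBlocks.mp hk) (V.mem_laterBlocks.mp hk''))
  refine ⟨⟨h6.obs.mono (V.segmentInfo_mono (Set.subset_univ _)), ?_⟩, mean₆ mean₅⟩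
  have hb := h6.bound
  -- Every qubit lies in some block or in the initial complement, so the strings now agree
  -- everywhere.
  suffices huniv : (Finset.univ.biUnion V.blockSupport)ᶜ ∪
      V.laterBlocks.toFinset.biUnion V.blockSupport ∪ s ∪
      V.earlierBlocks.toFinset.biUnion V.blockSupport = Finset.univ by
    rw [huniv] at hb
    exact hb
  rw [Finset.eq_univ_iff_forall]
  intro q
  by_cases hq : ∃ k, q ∈ V.blockSupport k
  · obtain ⟨k, hk⟩ := hq
    simp only [Finset.mem_union, Finset.mem_biUnion, List.mem_toFinset, mem_laterBlocks,
      mem_earlierBlocks]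
    rcases lt_trichotomy k V.diffBlock with h | rfl | h
    · exact .inr ⟨k, h, hk⟩
    · exact .inl (.inr hk)
    · exact .inl (.inl (.inr ⟨k, h, hk⟩))
  · refine Finset.mem_union_left _ (Finset.mem_union_left _ (Finset.mem_union_left _ ?_))
    simpa using hq

/-- The expectation of an observable in the initial state, in the Pauli basis. -/
theorem re_apply_zero_zero {N : ℕ} {A : QOp N} (hA : A.IsHermitian) :
    (A 0 0).re = ∑ Q : PauliString N, PauliString.coeff Q A *
      (if ∀ i, Q i = .I ∨ Q i = .Z then 1 else 0) := by
  conv_lhs => rw [← sum_coeff_smul_toOp hA]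
  rw [Matrix.sum_apply, Complex.re_sum]
  refine Finset.sum_congr rfl fun Q _ => ?_
  rw [Matrix.smul_apply, smul_eq_mul, Complex.re_ofReal_mul, toOp_zero_zero]
  split_ifs <;> simp

/-- With mean zero the variance is a second moment; full agreement leaves only its diagonal, tested
against the 0/1 indicator of strings in `I` and `Z`. That indicator is 1 at the end of every kept
path. -/
theorem Assumptions.sum_termWeight_le_gradVariance (hV : V.Assumptions) :
    ∑ h ∈ V.relevantTerms, V.termWeight h ≤ V.gradVariance := by
  obtain ⟨g, hgs, hg⟩ := hV.gen_pauli
  obtain ⟨⟨hobs, hbound⟩, hmean⟩ := hV.chainState_derivOp hgs hg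
  replace hobs := hobs.mono (hV.segmentInfo_le _)
  set t : PauliString V.numQubits → ℝ := fun Q => if ∀ i, Q i = .I ∨ Q i = .Z then 1 else 0 with ht
  have hX : V.costDeriv = fun θ => ∑ Q, PauliString.coeff Q (V.derivOp g θ) * t Q := by
    funext θ
    rw [V.costDeriv_eq hg, re_apply_zero_zero (hobs.herm θ)]
  have hint : ∀ Q, Integrable (fun θ => PauliString.coeff Q (V.derivOp g θ) * t Q) V.law :=
    fun Q => (hobs.integrable_coeff V.law Q).mul_const _
  have hE : ∫ θ, V.costDeriv θ ∂V.law = 0 := by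
    rw [hX, integral_finsetSum _ fun Q _ => hint Q]
    refine Finset.sum_eq_zero fun Q _ => ?_
    rw [integral_mul_const, hmean, zero_mul]
  have hmeas : AEMeasurable V.costDeriv V.law := by
    rw [hX]
    exact (integrable_finsetSum _ fun Q _ => hint Q).aemeasurable
  rw [gradVariance, variance_of_integral_eq_zero hmeas hE]
  have hsq : ∫ θ, V.costDeriv θ ^ 2 ∂V.law =
      ∑ Q, secondMoment V.law (V.derivOp g) Q Q * t Q := by
    have hint2 : ∀ Q Q', Integrable (fun θ => PauliString.coeff Q (V.derivOp g θ) * t Q *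
        (PauliString.coeff Q' (V.derivOp g θ) * t Q')) V.law := fun Q Q' => by
      convert (hobs.integrable_coeff_mul hobs V.law Q Q').mul_const (t Q * t Q') using 2
      ring
    simp only [hX, pow_two, Finset.sum_mul_sum]
    rw [integral_finsetSum _ fun Q _ => integrable_finsetSum _ fun Q' _ => hint2 Q Q']
    refine Finset.sum_congr rfl fun Q _ => ?_
    rw [integral_finsetSum _ fun Q' _ => hint2 Q Q']
    have hterm : ∀ Q', ∫ θ, PauliString.coeff Q (V.derivOp g θ) * t Q *
        (PauliString.coeff Q' (V.derivOp g θ) * t Q') ∂V.law =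
        secondMoment V.law (V.derivOp g) Q Q' * (t Q * t Q') := fun Q' => by
      rw [secondMoment, ← integral_mul_const]
      exact integral_congr_ae (.of_forall fun θ => by ring)
    simp only [hterm]
    rw [Finset.sum_eq_single Q]
    · have : t Q * t Q = t Q := by simp only [ht]; split_ifs <;> simp
      rw [this]
    · intro Q' _ hne
      have : secondMoment V.law (V.derivOp g) Q Q' = 0 := by
        by_contra h0
        exact hne (funext fun q => (hbound.agree Q Q' h0 q (Finset.mem_univ q)).symm)
      rw [this, zero_mul]
    · simp
  change _ ≤ ∫ θ, V.costDeriv θ ^ 2 ∂V.law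
  rw [hsq]
  refine le_trans (le_of_eq (Finset.sum_congr rfl fun h _ => ?_))
    (hbound.lower t fun Q => by simp only [ht]; split_ifs <;> norm_num)
  have : t (zify Finset.univ h) = 1 := by
    simp only [ht]
    refine if_pos fun i => ?_
    by_cases hi : h i = .I <;> simp [zify, hi]
  rw [this, mul_one]

end VQE

/-! ### Counting the blocks that meet a term, and the final bounds -/

namespace VQE

open PauliString

variable (V : VQE)

/-- Union bound: each of at most `r` qubits in the support lies in at most `χ` blocks. -/
theorem card_blocks_meeting_le {h : PauliString V.numQubits} (hh : h ∈ V.terms) :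
    (Finset.univ.filter fun k => (h.support ∩ V.blockSupport k).Nonempty).card ≤
      V.interactionRange * V.maxLocalDepth := by
  have hsub : (Finset.univ.filter fun k => (h.support ∩ V.blockSupport k).Nonempty) ⊆
      h.support.biUnion fun q => Finset.univ.filter fun k => q ∈ V.blockSupport k := by
    intro k hk
    obtain ⟨q, hq⟩ := (Finset.mem_filter.mp hk).2
    rw [Finset.mem_inter] at hq
    exact Finset.mem_biUnion.mpr ⟨q, hq.1, Finset.mem_filter.mpr ⟨Finset.mem_univ _, hq.2⟩⟩
  calc _ ≤ _ := Finset.card_le_card hsub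
    _ ≤ ∑ q ∈ h.support, V.localDepth q := Finset.card_biUnion_le
    _ ≤ ∑ _q ∈ h.support, V.maxLocalDepth :=
      Finset.sum_le_sum fun q _ => Finset.le_sup (f := V.localDepth) (Finset.mem_univ q)
    _ = h.support.card * V.maxLocalDepth := by rw [Finset.sum_const, smul_eq_mul]
    _ ≤ _ := Nat.mul_le_mul_right _ (Finset.le_sup (f := fun h => h.support.card) hh)

theorem inv_pow_le_prod_blockFactor {h : PauliString V.numQubits} (hh : h ∈ V.terms) :
    ((4 : ℝ) ^ (V.interactionRange * V.maxLocalDepth * V.maxBlockSize))⁻¹ ≤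
      ∏ k, blockFactor (V.blockSupport k) h := by
  have h1 : ∀ k, (if (h.support ∩ V.blockSupport k).Nonempty then
      ((4 : ℝ) ^ V.maxBlockSize)⁻¹ else 1) ≤ blockFactor (V.blockSupport k) h := fun k => by
    unfold blockFactor
    split_ifs with hk
    · exact inv_anti₀ (by positivity) (pow_le_pow_right₀ (by norm_num)
        (Finset.le_sup (f := fun k => (V.blockSupport k).card) (Finset.mem_univ k)))
    · exact le_rfl
  refine le_trans ?_ (Finset.prod_le_prod (fun k _ => by split_ifs <;> positivity) fun k _ => h1 k)
  rw [← Finset.prod_filter, Finset.prod_const, ← inv_pow, ← inv_pow, ← pow_mul, mul_comm _ (Finset.card _)]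
  exact pow_le_pow_of_le_one (by norm_num) (by norm_num)
    (Nat.mul_le_mul_right _ (V.card_blocks_meeting_le hh))

/-- A relevant term meets the differential block, so that block contributes its ordinary factor
times 2, and the product runs uniformly over all blocks. -/
theorem termWeight_eq {h : PauliString V.numQubits} (hh : h ∈ V.relevantTerms) :
    V.termWeight h = 2 * V.coeff h ^ 2 * ∏ k, blockFactor (V.blockSupport k) h := by
  have hnd : (List.finRange V.numBlocks).reverse.Nodup :=
    List.nodup_reverse.mpr (List.nodup_finRange _)
  have hnl : V.laterBlocks.Nodup := hnd.filter _
  have hne : V.earlierBlocks.Nodup := hnd.filter _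
  have huniv : (Finset.univ : Finset (Fin V.numBlocks)) =
      insert V.diffBlock (V.laterBlocks.toFinset ∪ V.earlierBlocks.toFinset) := by
    ext k
    simp only [Finset.mem_univ, Finset.mem_insert, Finset.mem_union, List.mem_toFinset,
      mem_laterBlocks, mem_earlierBlocks, true_iff]
    rcases lt_trichotomy k V.diffBlock with h | h | h <;> simp [h]
  have hdisj : Disjoint V.laterBlocks.toFinset V.earlierBlocks.toFinset := by
    rw [Finset.disjoint_left]
    intro k hk hk'
    rw [List.mem_toFinset] at hk hk'
    exact lt_asymm (V.mem_laterBlocks.mp hk) (V.mem_earlierBlocks.mp hk')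
  have hdiff : blockFactor (V.blockSupport V.diffBlock) h =
      ((4 : ℝ) ^ (V.blockSupport V.diffBlock).card)⁻¹ :=
    if_pos (Finset.mem_filter.mp hh).2
  rw [huniv, Finset.prod_insert (by simp [mem_laterBlocks, mem_earlierBlocks]),
    Finset.prod_union hdisj, List.prod_toFinset _ hnl, List.prod_toFinset _ hne,
    hdiff, termWeight]
  ring

theorem Assumptions.le_gradVariance {V : VQE} (hV : V.Assumptions) :
    (4 : ℝ) ^ (-((V.interactionRange * V.maxLocalDepth * V.maxBlockSize : ℕ) : ℤ)) *
      ∑ h ∈ V.relevantTerms, 2 * V.coeff h ^ 2 ≤ V.gradVariance := by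
  refine le_trans ?_ hV.sum_termWeight_le_gradVariance
  rw [zpow_neg, zpow_natCast, Finset.mul_sum]
  refine Finset.sum_le_sum fun h hh => ?_
  rw [V.termWeight_eq hh, mul_comm]
  exact mul_le_mul_of_nonneg_left (V.inv_pow_le_prod_blockFactor (Finset.mem_filter.mp hh).1)
    (by positivity)

end VQE

/-- Exponential decay with growing qubit number would force the variance to tend to zero. -/
theorem not_hasBarrenPlateau_of_le {V : ℕ → VQE} {ε : ℝ} (hε : 0 < ε)
    (h : ∀ n, ε ≤ (V n).gradVariance)
    (hN : Filter.Tendsto (fun n => (V n).numQubits) Filter.atTop Filter.atTop) :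
    ¬ HasBarrenPlateau V := by
  rintro ⟨b, hb, hO⟩
  have h0 : Filter.Tendsto (fun n => (b ^ (V n).numQubits)⁻¹) Filter.atTop (nhds 0) :=
    ((tendsto_pow_atTop_atTop_of_one_lt hb).comp hN).inv_tendsto_atTop
  have h1 := hO.trans_tendsto h0
  exact absurd (ge_of_tendsto' h1 h) (not_le.mpr hε)

/-- The lower bound on the variance of the cost derivative and, as a consequence, the absence of
barren plateaus for sequences of circuits of bounded local depth. -/
theorem theorem2 :
    (∀ V : VQE, V.Assumptions →
      (4 : ℝ) ^ (-((V.interactionRange * V.maxLocalDepth * V.maxBlockSize : ℕ) : ℤ)) *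
          ∑ h ∈ V.relevantTerms, 2 * V.coeff h ^ 2 ≤ V.gradVariance) ∧
    (∀ (V : ℕ → VQE) (r χ β : ℕ) (c : ℝ), 0 < c →
      (∀ n, (V n).Assumptions) →
      Filter.Tendsto (fun n => (V n).numQubits) Filter.atTop Filter.atTop →
      (∀ n, (V n).interactionRange ≤ r) →
      (∀ n, (V n).maxLocalDepth ≤ χ) →
      (∀ n, (V n).maxBlockSize ≤ β) →
      (∀ n, c ≤ ∑ h ∈ (V n).relevantTerms, (V n).coeff h ^ 2) →
      (∀ n, (4 : ℝ) ^ (-((r * χ * β : ℕ) : ℤ)) * (2 * c) ≤ (V n).gradVariance) ∧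
        ¬ HasBarrenPlateau V) := by
  refine ⟨fun V hV => hV.le_gradVariance, fun V r χ β c hc hV hN hr hχ hβ hl => ?_⟩
  have hle : ∀ n, (4 : ℝ) ^ (-((r * χ * β : ℕ) : ℤ)) * (2 * c) ≤ (V n).gradVariance := fun n => by
    refine le_trans ?_ (hV n).le_gradVariance
    rw [← Finset.mul_sum]
    refine mul_le_mul ?_ (mul_le_mul_of_nonneg_left (hl n) zero_le_two) (by positivity)
      (by positivity)
    exact zpow_le_zpow_right₀ (by norm_num) (neg_le_neg (by
      exact_mod_cast Nat.mul_le_mul (Nat.mul_le_mul (hr n) (hχ n)) (hβ n)))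
  exact ⟨hle, not_hasBarrenPlateau_of_le (by positivity) hle hN⟩
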